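/- All channels are discrete: a channel $W$ from a set $\mathcal X$ to a set $\mathcal Y$ assigns to each $x\in\mathcal X$ a discrete probability distribution $W_x$ on $\mathcal Y$; for a probability distribution $p$ on $\mathcal X$ put $W_p(y)=\sum_x p(x)W_x(y)$, and for a channel $Q$ from $\tilde{\mathcal X}$ to $\mathcal X$ put $(WQ)_{\tilde x}=W_{Q_{\tilde x}}$. Distributions have countable support; the sets are arbitrary. A general sequence of wire-tap channels consists of arbitrary sets $\mathcal X^n,\mathcal Y^n,\mathcal Z^n$ and arbitrary channels $W^{B,n}$ from $\mathcal X^n$ to $\mathcal Y^n$ and $W^{E,n}$ from $\mathcal X^n$ to $\mathcal Z^n$ ($n=1,2,\dots$); write $\mathbf W^B=\{W^{B,n}\}$, $\mathbf W^E=\{W^{E,n}\}$. A code $\Phi=(M,\{Q_i\}_{i=1}^M,\{\mathcal D_i\}_{i=1}^M)$ for a pair of channels $(W^B,W^E)$ consists of an integer $M=|\Phi|\ge 1$, probability distributions $Q_1,\dots,Q_M$ on the input set, and pairwise disjoint subsets $\mathcal D_1,\dots,\mathcal D_M$ of the output set of $W^B$. Put $$\epsilon_B(\Phi)=\frac1M\sum_{i}W^B_{Q_i}(\mathcal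 D_i^c),\qquad I_E(\Phi)=\frac1M\sum_i D\Bigl(W^E_{Q_i}\Big\|\frac1M\sum_j W^E_{Q_j}\Bigr),\qquad d_E(\Phi)=\frac1{M(M-1)}\sum_{i\ne j}d(W^E_{Q_i},W^E_{Q_j}),$$ where $D(p\|q)=\sum_y p(y)\log\frac{p(y)}{q(y)}$, $d(p,q)=\sum_y|p(y)-q(y)|$, and $d_E(\Phi)=0$ if $M=1$. The two secrecy capacities, with values in $[-\infty,\infty]$, are $$C_d(\mathbf W^B,\mathbf W^E)=\sup_{\{\Phi_n\}}\Bigl\{\liminf_{n\to\infty}\tfrac1n\log|\Phi_n|\;:\;\lim_{n\to\infty}\epsilon_B(\Phi_n)=\lim_{n\to\infty} d_E(\Phi_n)=0\Bigr\},$$ $$C_I(\mathbf W^B,\mathbf W^E)=\sup_{\{\Phi_n\}}\Bigl\{\liminf_{n\to\infty}\tfrac1n\log|\Phi_n|\;:\;\lim_{n\to\infty}\epsilon_B(\Phi_n)=\lim_{n\to\infty}\tfrac1n I_E(\Phi_n)=0\Bigr\},$$ where $\Phi_n$ is a code for $(W^{B,n},W^{E,n})$. For a sequence of channels $\mathbf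 W=\{W^n\}$ and a sequence $\mathbf p=\{p^n\}$ of input distributions let $$T_n(a)=\sum_x p^n(x)\,W^n_x\Bigl\{y:\tfrac1n\log\tfrac{W^n_x(y)}{W^n_{p^n}(y)}>a\Bigr\},$$ $$\underline I(1|\mathbf p,\mathbf W)=\inf\bigl\{a\in\mathbb R:\liminf_{n\to\infty}T_n(a)<1\bigr\},\qquad \overline I(0|\mathbf p,\mathbf W)=\inf\bigl\{a\in\mathbb R:\limsup_{n\to\infty}T_n(a)\le 0\bigr\},$$ with $\inf\emptyset=+\infty$. Theorem. For every general sequence of wire-tap channels $(\mathbf W^B,\mathbf W^E)$, $$C_d(\mathbf W^B,\mathbf W^E)=C_I(\mathbf W^B,\mathbf W^E)=\sup_{\mathbf p,\mathbf Q}\bigl\{\underline I(1|\mathbf p,\mathbf W^B\mathbf Q)-\overline I(0|\mathbf p,\mathbf W^E\mathbf Q)\bigr\},$$ where the supremum runs over all sequences $\mathbf Q=\{Q^n\}$ of channels from arbitrary sets $\tilde{\mathcal X}^n$ to $\mathcal X^n$ and all sequences $\mathbf p=\{p^n\}$ of probability distributions on $\tilde{\mathcal X}^n$, $\mathbf W\mathbf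 Q=\{W^nQ^n\}$, and pairs $(\mathbf p,\mathbf Q)$ for which the difference reads $\infty-\infty$ do not contribute. -/

import Mathlib

open Filter Topology
open scoped ENNReal

universe u u₁ u₂ v

namespace WireTap

/-- A (discrete) channel from `X` to `Y`: `W x` is the output distribution on input `x`. -/
abbrev Channel (X : Type u₁) (Y : Type u₂) : Type (max u₁ u₂) := X → PMF Y

/-- The output distribution `W_p(y) = ∑ x, p(x) W_x(y)` of the input distribution `p`. -/
noncomputable def output {X : Type u₁} {Y : Type u₂} (W : Channel X Y) (p : PMF X) : PMF Y :=
  p.bind W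

/-- The channel `W Q`, i.e. `(W Q)_v(y) = ∑ x, W_x(y) Q_v(x)`. -/
noncomputable def cascade {V : Type v} {X : Type u₁} {Y : Type u₂}
    (W : Channel X Y) (Q : Channel V X) : Channel V Y :=
  fun w => output W (Q w)

/-- The variational distance `d(p, q) = ∑ y, |p(y) - q(y)|` (the series always converges). -/
noncomputable def variationalDist {Y : Type u} (p q : PMF Y) : ℝ :=
  ∑' y, |(p y).toReal - (q y).toReal|

open Classical in
/-- The Kullback-Leibler divergence `D(p‖q) = ∑ y, p(y) log (p(y) / q(y))`. It is `+∞` if `p` is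
not absolutely continuous with respect to `q`; otherwise the negative terms of the series have a
finite sum, so that the series diverges to `+∞` when it is not summable. -/
noncomputable def klDivergence {Y : Type u} (p q : PMF Y) : EReal :=
  if p.support ⊆ q.support ∧
      Summable (fun y => (p y).toReal * Real.log ((p y).toReal / (q y).toReal)) then
    ((∑' y, (p y).toReal * Real.log ((p y).toReal / (q y).toReal) : ℝ) : EReal)
  else ⊤

/-- A wire-tap code with input alphabet `X` and output alphabet `Y` of the normal receiver:
message `i` is sent by drawing the input from `Q i`, and the receiver decides for `i` if its
output lies in `D i`. -/
structure Code (X : Type u₁) (Y : Type u₂) where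
  /-- the number of messages -/
  size : ℕ
  size_pos : 0 < size
  /-- the stochastic encoder -/
  Q : Fin size → PMF X
  /-- the decoding regions -/
  D : Fin size → Set Y
  disjoint : ∀ i j, i ≠ j → Disjoint (D i) (D j)

section Performance

variable {X : Type u} {Y : Type u₁} {Z : Type u₂}

/-- The average error probability of the normal receiver. -/
noncomputable def Code.errorB (Φ : Code X Y) (WB : Channel X Y) : ℝ≥0∞ :=
  (∑ i, (output WB (Φ.Q i)).toOuterMeasure (Φ.D i)ᶜ) / (Φ.size : ℝ≥0∞)

/-- The uniform distribution on the messages of a code. -/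
noncomputable def Code.uniformMessage (Φ : Code X Y) : PMF (Fin Φ.size) :=
  haveI : Nonempty (Fin Φ.size) := ⟨⟨0, Φ.size_pos⟩⟩
  PMF.uniformOfFintype (Fin Φ.size)

/-- The output distribution `∑ i, (1 / M) W^E_{Q_i}` of the wire-tapper. -/
noncomputable def Code.outputE (Φ : Code X Y) (WE : Channel X Z) : PMF Z :=
  Φ.uniformMessage.bind (fun i => output WE (Φ.Q i))

/-- The wire-tapper's information `∑ i, (1 / M) D(W^E_{Q_i} ‖ W^E_Φ)` on the message. -/
noncomputable def Code.infoE (Φ : Code X Y) (WE : Channel X Z) : EReal :=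
  ∑ i, (((Φ.size : ℝ)⁻¹ : ℝ) : EReal) * klDivergence (output WE (Φ.Q i)) (Φ.outputE WE)

/-- The average variational distance `(1 / (M (M - 1))) ∑_{i ≠ j} d(W^E_{Q_i}, W^E_{Q_j})`
(which is `0`, as an empty sum, when there is only one message). -/
noncomputable def Code.distE (Φ : Code X Y) (WE : Channel X Z) : ℝ :=
  ((Φ.size : ℝ) * ((Φ.size : ℝ) - 1))⁻¹ *
    ∑ i, ∑ j, if i = j then 0 else variationalDist (output WE (Φ.Q i)) (output WE (Φ.Q j))

end Performance

section Asymptotics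

variable {X : ℕ → Type u} {Y : ℕ → Type u₁} {Z : ℕ → Type u₂}

/-- The asymptotic rate `liminf (1 / n) log |Φ_n|` of a sequence of codes. -/
noncomputable def rate (Φ : ∀ n, Code (X n) (Y n)) : EReal :=
  liminf (fun n : ℕ => (((1 / (n : ℝ)) * Real.log ((Φ n).size : ℝ) : ℝ) : EReal)) atTop

/-- The secrecy capacity for vanishing error probability and vanishing average variational
distance. -/
noncomputable def capacityD (WB : ∀ n, Channel (X n) (Y n)) (WE : ∀ n, Channel (X n) (Z n)) :
    EReal :=
  sSup {R | ∃ Φ : ∀ n, Code (X n) (Y n),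
    Tendsto (fun n => (Φ n).errorB (WB n)) atTop (𝓝 0) ∧
    Tendsto (fun n => (Φ n).distE (WE n)) atTop (𝓝 0) ∧ R = rate Φ}

/-- The secrecy capacity for vanishing error probability and vanishing information per
transmission of the wire-tapper. -/
noncomputable def capacityI (WB : ∀ n, Channel (X n) (Y n)) (WE : ∀ n, Channel (X n) (Z n)) :
    EReal :=
  sSup {R | ∃ Φ : ∀ n, Code (X n) (Y n),
    Tendsto (fun n => (Φ n).errorB (WB n)) atTop (𝓝 0) ∧
    Tendsto (fun n : ℕ => (Φ n).infoE (WE n) / (((n : ℝ)) : EReal)) atTop (𝓝 0) ∧ R = rate Φ}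

/-- The probability `E_p W_x {y | (1 / n) log (W_x(y) / W_p(y)) > a}`. Pairs `(x, y)` with
`W_x(y) = 0`, or with `W_p(y) = 0`, carry no weight in it. -/
noncomputable def spectrumTail {A : Type u} {B : Type u₁} (n : ℕ) (p : PMF A) (W : Channel A B)
    (a : ℝ) : ℝ≥0∞ :=
  ∑' x, p x * (W x).toOuterMeasure
    {y | a < (1 / (n : ℝ)) * Real.log ((W x y).toReal / (output W p y).toReal)}

/-- The upper information spectrum quantity `Ī(ε|p, W)`: the infimum in `[-∞, ∞]` of the reals `a`
with `limsup E_p W_x {(1 / n) log (W_x / W_p) > a} ≤ ε` (with `<` in place of `≤` if `ε = 1`). -/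
noncomputable def upperI (ε : ℝ≥0∞) (p : ∀ n, PMF (X n)) (W : ∀ n, Channel (X n) (Y n)) : EReal :=
  sInf {b | ∃ a : ℝ, b = (a : EReal) ∧
    if ε = 1 then limsup (fun n => spectrumTail n (p n) (W n) a) atTop < ε
    else limsup (fun n => spectrumTail n (p n) (W n) a) atTop ≤ ε}

/-- The lower information spectrum quantity `I̲(ε|p, W)`: the infimum in `[-∞, ∞]` of the reals `a`
with `liminf E_p W_x {(1 / n) log (W_x / W_p) > a} ≤ ε` (with `<` in place of `≤` if `ε = 1`). -/
noncomputable def lowerI (ε : ℝ≥0∞) (p : ∀ n, PMF (X n)) (W : ∀ n, Channel (X n) (Y n)) : EReal :=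
  sInf {b | ∃ a : ℝ, b = (a : EReal) ∧
    if ε = 1 then liminf (fun n => spectrumTail n (p n) (W n) a) atTop < ε
    else liminf (fun n => spectrumTail n (p n) (W n) a) atTop ≤ ε}

/-- The supremum over all sequences of sets `V n`, distributions `p n` on `V n`, and channels `Q n`
from `V n` to `X n` of `I̲(1|p, W^B Q) - Ī(0|p, W^E Q)`. In `EReal` one has `⊤ - ⊤ = ⊥`, so that
an undefined difference `∞ - ∞` does not contribute. -/
noncomputable def prefixSup (WB : ∀ n, Channel (X n) (Y n)) (WE : ∀ n, Channel (X n) (Z n)) :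
    EReal :=
  ⨆ (V : ℕ → Type v) (p : ∀ n, PMF (V n)) (Q : ∀ n, Channel (V n) (X n)),
    lowerI 1 p (fun n => cascade (WB n) (Q n)) - upperI 0 p (fun n => cascade (WE n) (Q n))

end Asymptotics

end WireTap

/-! Everything is expressed through the law of the likelihood ratio W_x(y) / W_p(y): for n ≥ 1 the
spectrum tail at level a is the probability `exceedance` that the ratio is above e^{na}, and
`shortfall` is the complementary probability.

Converse. Take the uniformly distributed message of a code as prefix input and the encoder as prefix
channel. Reliable decoding forces the ratio at B to exceed every c much smaller than M with high
probability (`Code.shortfall_messageChannel_le`), so the rate is at most I̲(1). Secrecy forces the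
ratio at E to stay below e^{na} for every a > 0, whether it is measured by variational distance
(`Code.one_sub_inv_mul_exceedance_le`) or by divergence (`Code.log_mul_exceedance_le`), so Ī(0) ≤ 0.
Hence the rate is bounded by the difference.

Direct part. Let a < I̲(1), Ī(0) < b and 0 ≤ R < a - b. Draw M ≈ e^{nR} blocks of L ≈ e^{n(b+δ)}
independent codewords, one block per message, and send a uniform codeword of the block. Threshold
decoding succeeds because ML is much smaller than e^{na} (`lintegral_errorB_le`). Each block
imitates the output distribution of p at E because L is much larger than e^{nb}
(`lintegral_tsum_abs_mean_sub_output_le`), so d_E vanishes. Since I_E ≤ d_E (1 + log M)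
(`Code.infoEReal_le`) and log M = O(n), I_E / n vanishes for the same codes, and both capacities are
reached at once. -/

namespace WireTap

/-! ### Likelihood ratios and the information spectrum -/

section Spectrum

variable {A : Type u} {B : Type u₁} {V : Type v}

/-- The probability that the likelihood ratio `W_x(y) / W_p(y)` exceeds `c`. -/
noncomputable def exceedance (p : PMF A) (W : Channel A B) (c : ℝ≥0∞) : ℝ≥0∞ :=
  ∑' x, p x * (W x).toOuterMeasure {y | c * output W p y < W x y}

/-- The probability that the likelihood ratio `W_x(y) / W_p(y)` is at most `c`. -/
noncomputable def shortfall (p : PMF A) (W : Channel A B) (c : ℝ≥0∞) : ℝ≥0∞ :=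
  ∑' x, p x * (W x).toOuterMeasure {y | W x y ≤ c * output W p y}

lemma output_apply (W : Channel A B) (p : PMF A) (y : B) :
    output W p y = ∑' x, p x * W x y := PMF.bind_apply _ _ _

lemma mul_le_output (W : Channel A B) (p : PMF A) (x : A) (y : B) :
    p x * W x y ≤ output W p y := by
  rw [output_apply]; exact ENNReal.le_tsum x

lemma toOuterMeasure_add_compl (q : PMF B) (s : Set B) :
    q.toOuterMeasure s + q.toOuterMeasure sᶜ = 1 := by
  rw [PMF.toOuterMeasure_apply, PMF.toOuterMeasure_apply, ← ENNReal.tsum_add, ← q.tsum_coe]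
  refine tsum_congr fun y => ?_
  by_cases h : y ∈ s <;> simp [h]

lemma toOuterMeasure_le_one (q : PMF B) (s : Set B) : q.toOuterMeasure s ≤ 1 := by
  rw [← toOuterMeasure_add_compl q s]; exact le_self_add

lemma toOuterMeasure_eq_sum_indicator (q : PMF B) (s : Set B) :
    q.toOuterMeasure s = ∑' y, s.indicator q y := PMF.toOuterMeasure_apply _ _

lemma toOuterMeasure_le_of_forall (q r : PMF B) (s : Set B) (c : ℝ≥0∞)
    (h : ∀ y ∈ s, q y ≤ c * r y) : q.toOuterMeasure s ≤ c * r.toOuterMeasure s := by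
  rw [toOuterMeasure_eq_sum_indicator, toOuterMeasure_eq_sum_indicator, ← ENNReal.tsum_mul_left]
  refine ENNReal.tsum_le_tsum fun y => ?_
  by_cases hy : y ∈ s
  · simpa [hy] using h y hy
  · simp [hy]

lemma toOuterMeasure_output (W : Channel A B) (p : PMF A) (s : Set B) :
    (output W p).toOuterMeasure s = ∑' x, p x * (W x).toOuterMeasure s :=
  PMF.toOuterMeasure_bind_apply _ _ _

lemma exceedance_add_shortfall (p : PMF A) (W : Channel A B) (c : ℝ≥0∞) :
    exceedance p W c + shortfall p W c = 1 := by
  rw [exceedance, shortfall, ← ENNReal.tsum_add, ← p.tsum_coe]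
  refine tsum_congr fun x => ?_
  rw [← mul_add]
  have : {y | W x y ≤ c * output W p y} = {y | c * output W p y < W x y}ᶜ := by ext; simp
  rw [this, toOuterMeasure_add_compl, mul_one]

lemma exceedance_le_one (p : PMF A) (W : Channel A B) (c : ℝ≥0∞) : exceedance p W c ≤ 1 := by
  rw [← exceedance_add_shortfall p W c]; exact le_self_add

/-- On this event W_x is at most c times the output distribution, whose total mass is 1. This is
what keeps the threshold b of the direct part nonnegative. -/
lemma shortfall_le (p : PMF A) (W : Channel A B) (c : ℝ≥0∞) : shortfall p W c ≤ c := by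
  calc shortfall p W c ≤ ∑' x, p x * c := by
        refine ENNReal.tsum_le_tsum fun x => mul_le_mul_right ?_ _
        refine (toOuterMeasure_le_of_forall (W x) (output W p) _ c fun y hy => hy).trans ?_
        exact (mul_le_mul_right (toOuterMeasure_le_one _ _) c).trans (mul_one c).le
    _ = c := by rw [ENNReal.tsum_mul_right, p.tsum_coe, one_mul]

lemma lt_log_ratio_iff {n : ℕ} (hn : 0 < n) (a : ℝ) {s t : ℝ≥0∞} (hs : s ≠ 0) (ht : t ≠ 0)
    (hs' : s ≠ ⊤) (ht' : t ≠ ⊤) :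
    a < 1 / (n : ℝ) * Real.log (s.toReal / t.toReal) ↔
      ENNReal.ofReal (Real.exp (n * a)) * t < s := by
  have hs0 := ENNReal.toReal_pos hs hs'
  have ht0 := ENNReal.toReal_pos ht ht'
  have hn' : (0 : ℝ) < n := by exact_mod_cast hn
  rw [one_div_mul_eq_div, lt_div_iff₀ hn', mul_comm a, Real.lt_log_iff_exp_lt (by positivity),
    lt_div_iff₀ ht0]
  nth_rw 2 [← ENNReal.ofReal_toReal hs']
  nth_rw 2 [← ENNReal.ofReal_toReal ht']
  rw [← ENNReal.ofReal_mul (by positivity), ENNReal.ofReal_lt_ofReal_iff hs0]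

lemma spectrumTail_eq {n : ℕ} (hn : 0 < n) (p : PMF A) (W : Channel A B) (a : ℝ) :
    spectrumTail n p W a = exceedance p W (ENNReal.ofReal (Real.exp (n * a))) := by
  refine tsum_congr fun x => ?_
  by_cases hx : p x = 0
  · simp [hx]
  congr 1
  -- Off the support of W_x the default value log 0 = 0 may put points into one set only; they carry
  -- no mass.
  refine PMF.toOuterMeasure_apply_eq_of_inter_support_eq _ ?_
  ext y
  simp only [Set.mem_inter_iff, Set.mem_ofPred_eq, PMF.mem_support_iff]
  refine and_congr_left fun hy => lt_log_ratio_iff hn a hy ?_ (PMF.apply_ne_top _ _)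
    (PMF.apply_ne_top _ _)
  exact fun h => mul_ne_zero hx hy (le_antisymm (h ▸ mul_le_output W p x y) zero_le)

lemma tsum_map_mul (p : PMF V) (e : V → A) (g : A → ℝ≥0∞) :
    ∑' x, p.map e x * g x = ∑' w, p w * g (e w) := by
  classical
  simp_rw [PMF.map_apply, ← ENNReal.tsum_mul_right]
  rw [ENNReal.tsum_comm]
  refine tsum_congr fun w => ?_
  rw [tsum_eq_single (e w) (fun x hx => by simp [hx])]
  simp

lemma output_map (W : Channel A B) (p : PMF V) (e : V → A) :
    output W (p.map e) = output (W ∘ e) p := PMF.bind_map _ _ _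

lemma exceedance_map (W : Channel A B) (p : PMF V) (e : V → A) (c : ℝ≥0∞) :
    exceedance (p.map e) W c = exceedance p (W ∘ e) c := by
  rw [exceedance, tsum_map_mul, output_map]; rfl

lemma shortfall_map (W : Channel A B) (p : PMF V) (e : V → A) (c : ℝ≥0∞) :
    shortfall (p.map e) W c = shortfall p (W ∘ e) c := by
  rw [shortfall, tsum_map_mul, output_map]; rfl

/-- Restricting p to its support makes codebooks range over a countable set, where every function is
measurable for the discrete σ-algebra. -/
lemma exists_countable_map_eq (p : PMF A) :
    ∃ (S : Set A) (_ : Countable S) (q : PMF S), q.map Subtype.val = p := by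
  have key (g : A → ℝ≥0∞) : ∑' v : p.support, p v * g v = ∑' v, p v * g v := by
    rw [tsum_subtype p.support fun v => p v * g v]
    refine tsum_congr fun y => ?_
    by_cases hy : p y = 0 <;> simp [Set.indicator, hy]
  let q : PMF p.support := ⟨fun v => p v, by
    have h := key 1
    simp only [Pi.one_apply, mul_one, p.tsum_coe] at h
    exact h ▸ ENNReal.summable.hasSum⟩
  refine ⟨p.support, p.support_countable, q, ?_⟩
  have h1 (r : PMF A) (x : A) : ∑' y, r y * Set.indicator {x} 1 y = r x := by
    rw [tsum_eq_single x (fun y hy => by simp [hy])]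
    simp
  ext x
  rw [← h1, tsum_map_mul, ← h1 p, ← key]
  rfl

end Spectrum

/-! ### Decoding error against the likelihood ratio at the receiver -/

section Codes

variable {X : Type u} {Y : Type u₁} {Z : Type u₂}

/-- The channel from the messages of a code to the output. -/
noncomputable def Code.messageChannel (Φ : Code X Y) (W : Channel X Z) :
    Channel (Fin Φ.size) Z := cascade W Φ.Q

lemma Code.uniformMessage_apply (Φ : Code X Y) (i : Fin Φ.size) :
    Φ.uniformMessage i = (Φ.size : ℝ≥0∞)⁻¹ := by
  simp [Code.uniformMessage, PMF.uniformOfFintype_apply]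

lemma sum_toOuterMeasure_le_one {ι : Type*} [Fintype ι] (q : PMF Y) (D : ι → Set Y)
    (hD : ∀ i j, i ≠ j → Disjoint (D i) (D j)) : ∑ i, q.toOuterMeasure (D i) ≤ 1 := by
  simp_rw [toOuterMeasure_eq_sum_indicator]
  rw [← Summable.tsum_finsetSum (fun _ _ => ENNReal.summable), ← q.tsum_coe]
  refine ENNReal.tsum_le_tsum fun y => ?_
  by_cases h : ∃ i, y ∈ D i
  · obtain ⟨i, hi⟩ := h
    rw [Finset.sum_eq_single i]
    · simp [hi]
    · intro j _ hj
      exact Set.indicator_of_notMem (fun hy => Set.disjoint_left.1 (hD j i hj) hy hi) _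
    · simp
  · push Not at h
    simp [h]

/-- Small ratio means either an output outside D_i, which is an error, or one inside D_i, where W_i
≤ c r. As the D_i are disjoint, the r-masses of the latter add up to at most 1, leaving c / M. -/
lemma Code.shortfall_messageChannel_le (Φ : Code X Y) (W : Channel X Y) (c : ℝ≥0∞) :
    shortfall Φ.uniformMessage (Φ.messageChannel W) c ≤ Φ.errorB W + c / Φ.size := by
  set r := output (Φ.messageChannel W) Φ.uniformMessage
  rw [shortfall, tsum_fintype]
  simp_rw [Code.uniformMessage_apply]
  calc ∑ i, (Φ.size : ℝ≥0∞)⁻¹ * (Φ.messageChannel W i).toOuterMeasure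
        {y | Φ.messageChannel W i y ≤ c * r y}
      ≤ ∑ i, (Φ.size : ℝ≥0∞)⁻¹ * ((Φ.messageChannel W i).toOuterMeasure (Φ.D i)ᶜ +
          c * r.toOuterMeasure (Φ.D i)) := by
        refine Finset.sum_le_sum fun i _ => mul_le_mul_right ?_ _
        have hsub : {y | Φ.messageChannel W i y ≤ c * r y} ⊆
            (Φ.D i)ᶜ ∪ ({y | Φ.messageChannel W i y ≤ c * r y} ∩ Φ.D i) := by
          intro y hy
          by_cases h : y ∈ Φ.D i
          · exact Or.inr ⟨hy, h⟩
          · exact Or.inl h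
        refine (MeasureTheory.measure_mono hsub).trans
          ((MeasureTheory.measure_union_le _ _).trans (add_le_add_right ?_ _))
        refine (toOuterMeasure_le_of_forall _ r _ c fun y hy => hy.1).trans ?_
        exact mul_le_mul_right (MeasureTheory.measure_mono Set.inter_subset_right) _
    _ = Φ.errorB W + c / Φ.size * ∑ i, r.toOuterMeasure (Φ.D i) := by
        simp only [mul_add, Finset.sum_add_distrib, ← Finset.mul_sum]
        rw [Code.errorB, ENNReal.div_eq_inv_mul, ENNReal.div_eq_inv_mul, mul_assoc]
        rfl
    _ ≤ Φ.errorB W + c / Φ.size := by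
        refine add_le_add_right ?_ _
        exact (mul_le_mul_right (sum_toOuterMeasure_le_one r Φ.D Φ.disjoint) _).trans
          (mul_one _).le

end Codes

/-! ### Divergence and variational distance of discrete distributions -/

section Divergence

variable {B : Type u}

lemma summable_toReal_pmf (p : PMF B) : Summable fun y => (p y).toReal :=
  ENNReal.summable_toReal p.tsum_coe_ne_top

lemma tsum_toReal_pmf (p : PMF B) : ∑' y, (p y).toReal = 1 := by
  rw [← ENNReal.tsum_toReal_eq (fun y => p.apply_ne_top y), p.tsum_coe, ENNReal.toReal_one]

lemma summable_abs_sub (p q : PMF B) : Summable fun y => |(p y).toReal - (q y).toReal| :=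
  ((summable_toReal_pmf p).sub (summable_toReal_pmf q)).abs

lemma variationalDist_nonneg (p q : PMF B) : 0 ≤ variationalDist p q :=
  tsum_nonneg fun _ => abs_nonneg _

lemma variationalDist_self (p : PMF B) : variationalDist p p = 0 := by
  simp [variationalDist]

lemma variationalDist_comm (p q : PMF B) : variationalDist p q = variationalDist q p := by
  simp_rw [variationalDist, abs_sub_comm]

lemma variationalDist_triangle (p q r : PMF B) :
    variationalDist p r ≤ variationalDist p q + variationalDist q r := by
  rw [variationalDist, variationalDist, variationalDist,
    ← (summable_abs_sub p q).tsum_add (summable_abs_sub q r)]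
  exact (summable_abs_sub p r).tsum_le_tsum (fun y => abs_sub_le _ _ _)
    ((summable_abs_sub p q).add (summable_abs_sub q r))

lemma ofReal_variationalDist (p q : PMF B) :
    ENNReal.ofReal (variationalDist p q) =
      ∑' y, ENNReal.ofReal |(p y).toReal - (q y).toReal| :=
  ENNReal.ofReal_tsum_of_nonneg (fun _ => abs_nonneg _) (summable_abs_sub p q)

lemma toReal_toOuterMeasure (p : PMF B) (s : Set B) :
    (p.toOuterMeasure s).toReal = ∑' y, s.indicator (fun y => (p y).toReal) y := by
  rw [toOuterMeasure_eq_sum_indicator, ENNReal.tsum_toReal_eq]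
  · refine tsum_congr fun y => ?_
    by_cases h : y ∈ s <;> simp [h]
  · intro y
    by_cases h : y ∈ s <;> simp [h, p.apply_ne_top]

lemma summable_indicator_pmf (p : PMF B) (s : Set B) :
    Summable fun y => s.indicator (fun y => (p y).toReal) y :=
  (summable_toReal_pmf p).indicator s

lemma sub_le_mul_log_div {s t : ℝ} (hs : 0 ≤ s) (ht : 0 ≤ t) (h : t = 0 → s = 0) :
    s - t ≤ s * Real.log (s / t) := by
  rcases hs.eq_or_lt with rfl | hs
  · simpa using ht
  have ht : 0 < t := lt_of_le_of_ne ht fun h0 => hs.ne' (h h0.symm)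
  have h1 := Real.one_sub_inv_le_log_of_pos (div_pos hs ht)
  calc s - t = s * (1 - (s / t)⁻¹) := by field_simp
    _ ≤ _ := mul_le_mul_of_nonneg_left h1 hs.le

/-- For s ≥ t, write s = t + (s - t): log u ≤ u - 1 gives t log(s/t) ≤ s - t, and log(s/t) ≤ log M
handles the rest. For s ≤ t the left side is nonpositive. -/
lemma mul_log_div_le {s t M : ℝ} (hs : 0 ≤ s) (ht : 0 ≤ t) (hM : 1 ≤ M) (h : s ≤ M * t) :
    s * Real.log (s / t) ≤ |s - t| * (1 + Real.log M) := by
  have hlM : 0 ≤ Real.log M := Real.log_nonneg hM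
  rcases hs.eq_or_lt with rfl | hs
  · simp only [zero_mul]; positivity
  have ht : 0 < t := lt_of_le_of_ne ht fun h0 => by rw [← h0] at h; simp at h; linarith
  rcases le_total s t with hst | hst
  · have : Real.log (s / t) ≤ 0 := Real.log_nonpos (by positivity) ((div_le_one ht).2 hst)
    exact (mul_nonpos_of_nonneg_of_nonpos hs.le this).trans (by positivity)
  · rw [abs_of_nonneg (by linarith)]
    have h1 : Real.log (s / t) ≤ Real.log M :=
      Real.log_le_log (by positivity) ((div_le_iff₀ ht).2 h)
    have h2 := Real.log_le_sub_one_of_pos (div_pos hs ht)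
    have h3 : t * Real.log (s / t) ≤ s - t := by
      calc t * Real.log (s / t) ≤ t * (s / t - 1) := mul_le_mul_of_nonneg_left h2 ht.le
        _ = s - t := by field_simp
    have h4 := mul_le_mul_of_nonneg_left h1 (sub_nonneg.2 hst)
    linarith

/-- The value of the series `∑ y, p(y) log (p(y) / q(y))`. -/
noncomputable def klSum (p q : PMF B) : ℝ :=
  ∑' y, (p y).toReal * Real.log ((p y).toReal / (q y).toReal)

variable {p q : PMF B} {M : ℝ}

lemma abs_mul_log_div_le (hM : 1 ≤ M) (h : ∀ y, (p y).toReal ≤ M * (q y).toReal) (y : B) :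
    |(p y).toReal * Real.log ((p y).toReal / (q y).toReal)| ≤
      |(p y).toReal - (q y).toReal| * (1 + Real.log M) := by
  have hp : 0 ≤ (p y).toReal := ENNReal.toReal_nonneg
  have hq : 0 ≤ (q y).toReal := ENNReal.toReal_nonneg
  refine abs_le.2 ⟨?_, mul_log_div_le hp hq hM (h y)⟩
  have h1 := sub_le_mul_log_div hp hq fun h0 => le_antisymm (by simpa [h0] using h y) hp
  have h2 := neg_abs_le ((p y).toReal - (q y).toReal)
  have h3 : 0 ≤ |(p y).toReal - (q y).toReal| * Real.log M :=
    mul_nonneg (abs_nonneg _) (Real.log_nonneg hM)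
  linarith

lemma summable_mul_log_div (hM : 1 ≤ M) (h : ∀ y, (p y).toReal ≤ M * (q y).toReal) :
    Summable fun y => (p y).toReal * Real.log ((p y).toReal / (q y).toReal) :=
  Summable.of_norm_bounded ((summable_abs_sub p q).mul_right _) (abs_mul_log_div_le hM h)

lemma klDivergence_eq (hM : 1 ≤ M) (h : ∀ y, (p y).toReal ≤ M * (q y).toReal) :
    klDivergence p q = (klSum p q : EReal) := by
  refine if_pos ⟨fun y hy hy' => hy ?_, summable_mul_log_div hM h⟩
  have := h y
  simp only [hy', ENNReal.toReal_zero, mul_zero] at this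
  exact ((ENNReal.toReal_eq_zero_iff _).1 (le_antisymm this ENNReal.toReal_nonneg)).resolve_right
    (p.apply_ne_top y)

lemma klSum_le (hM : 1 ≤ M) (h : ∀ y, (p y).toReal ≤ M * (q y).toReal) :
    klSum p q ≤ variationalDist p q * (1 + Real.log M) := by
  rw [klSum, variationalDist, ← tsum_mul_right]
  exact (summable_mul_log_div hM h).tsum_le_tsum
    (fun y => (le_abs_self _).trans (abs_mul_log_div_le hM h y)) ((summable_abs_sub p q).mul_right _)

lemma klSum_nonneg (hM : 1 ≤ M) (h : ∀ y, (p y).toReal ≤ M * (q y).toReal) :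
    0 ≤ klSum p q := by
  have h0 : ∑' y, ((p y).toReal - (q y).toReal) = 0 := by
    rw [(summable_toReal_pmf p).tsum_sub (summable_toReal_pmf q), tsum_toReal_pmf,
      tsum_toReal_pmf, sub_self]
  rw [← h0]
  refine ((summable_toReal_pmf p).sub (summable_toReal_pmf q)).tsum_le_tsum (fun y => ?_)
    (summable_mul_log_div hM h)
  exact sub_le_mul_log_div ENNReal.toReal_nonneg ENNReal.toReal_nonneg fun h0 =>
    le_antisymm (by simpa [h0] using h y) ENNReal.toReal_nonneg

lemma toReal_lt_of_ofReal_mul_lt {c : ℝ} (hc : 0 ≤ c) {y : B}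
    (hy : ENNReal.ofReal c * q y < p y) : c * (q y).toReal < (p y).toReal := by
  have := ENNReal.toReal_strict_mono (p.apply_ne_top y) hy
  rwa [ENNReal.toReal_mul, ENNReal.toReal_ofReal hc] at this

/-- A Markov inequality for the log-likelihood ratio. The extra 1 is the mass of q: every term p
log(p/q) + q is at least p ≥ 0, so the terms off the event can be dropped. -/
lemma log_mul_toOuterMeasure_le (hM : 1 ≤ M) (h : ∀ y, (p y).toReal ≤ M * (q y).toReal)
    {c : ℝ} (hc : 1 ≤ c) :
    Real.log c * (p.toOuterMeasure {y | ENNReal.ofReal c * q y < p y}).toReal ≤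
      klSum p q + 1 := by
  rw [toReal_toOuterMeasure, ← tsum_toReal_pmf q, klSum, ← tsum_mul_left,
    ← (summable_mul_log_div hM h).tsum_add (summable_toReal_pmf q)]
  refine ((summable_indicator_pmf p _).mul_left _).tsum_le_tsum (fun y => ?_)
    ((summable_mul_log_div hM h).add (summable_toReal_pmf q))
  have hp : 0 ≤ (p y).toReal := ENNReal.toReal_nonneg
  have hq : 0 ≤ (q y).toReal := ENNReal.toReal_nonneg
  by_cases hy : ENNReal.ofReal c * q y < p y
  · rw [Set.indicator_of_mem (by exact hy)]
    have h1 := toReal_lt_of_ofReal_mul_lt (by linarith) hy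
    have hq' : 0 < (q y).toReal := by
      refine lt_of_le_of_ne hq fun h0 => ?_
      have := h y
      rw [← h0] at this h1
      linarith
    have h2 : Real.log c ≤ Real.log ((p y).toReal / (q y).toReal) :=
      Real.log_le_log (by linarith) ((le_div_iff₀ hq').2 h1.le)
    have := mul_le_mul_of_nonneg_left h2 hp
    linarith
  · rw [Set.indicator_of_notMem (by exact hy), mul_zero]
    have := sub_le_mul_log_div hp hq fun h0 => le_antisymm (by simpa [h0] using h y) hp
    linarith

/-- Where p > c q one has p - q ≥ (1 - 1/c) p. -/
lemma one_sub_inv_mul_toOuterMeasure_le (p q : PMF B) {c : ℝ} (hc : 0 < c) :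
    (1 - c⁻¹) * (p.toOuterMeasure {y | ENNReal.ofReal c * q y < p y}).toReal ≤
      variationalDist p q := by
  rw [toReal_toOuterMeasure, variationalDist, ← tsum_mul_left]
  refine ((summable_indicator_pmf p _).mul_left _).tsum_le_tsum (fun y => ?_)
    (summable_abs_sub p q)
  by_cases hy : ENNReal.ofReal c * q y < p y
  · rw [Set.indicator_of_mem (by exact hy)]
    have h1 := toReal_lt_of_ofReal_mul_lt hc.le hy
    have h2 : (q y).toReal ≤ c⁻¹ * (p y).toReal := by
      rw [inv_mul_eq_div, le_div_iff₀ hc]; linarith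
    refine le_trans ?_ (le_abs_self _)
    linarith
  · rw [Set.indicator_of_notMem (by exact hy), mul_zero]
    exact abs_nonneg _

end Divergence

/-! ### The two secrecy criteria and the likelihood ratio at the wire-tapper -/

section Secrecy

variable {X : Type u} {Y : Type u₁} {Z : Type u₂}

lemma Code.toReal_outputE (Φ : Code X Y) (W : Channel X Z) (z : Z) :
    (Φ.outputE W z).toReal = (Φ.size : ℝ)⁻¹ * ∑ i, (output W (Φ.Q i) z).toReal := by
  rw [Code.outputE, PMF.bind_apply, tsum_fintype, ENNReal.toReal_sum, Finset.mul_sum]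
  · simp [Code.uniformMessage_apply]
  · exact fun i _ => ENNReal.mul_ne_top (PMF.apply_ne_top _ _) (PMF.apply_ne_top _ _)

lemma Code.one_le_size (Φ : Code X Y) : (1 : ℝ) ≤ Φ.size := by exact_mod_cast Φ.size_pos

/-- A single term is at most the whole sum. This domination makes all divergences of a code finite
and supplies the constant log M. -/
lemma Code.le_size_mul_outputE (Φ : Code X Y) (W : Channel X Z) (i : Fin Φ.size) (z : Z) :
    (output W (Φ.Q i) z).toReal ≤ (Φ.size : ℝ) * (Φ.outputE W z).toReal := by
  have := Φ.one_le_size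
  rw [Φ.toReal_outputE, mul_inv_cancel_left₀ (by positivity)]
  exact Finset.single_le_sum (f := fun i => (output W (Φ.Q i) z).toReal)
    (fun _ _ => ENNReal.toReal_nonneg) (Finset.mem_univ i)

lemma Code.variationalDist_outputE_le (Φ : Code X Y) (W : Channel X Z) (p : PMF Z) :
    variationalDist p (Φ.outputE W) ≤
      (Φ.size : ℝ)⁻¹ * ∑ j, variationalDist p (output W (Φ.Q j)) := by
  have hM := Φ.one_le_size
  have hs (j : Fin Φ.size) := summable_abs_sub p (output W (Φ.Q j))
  simp_rw [variationalDist]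
  rw [← Summable.tsum_finsetSum (fun j _ => hs j), ← tsum_mul_left]
  refine (summable_abs_sub _ _).tsum_le_tsum (fun z => ?_)
    ((summable_sum fun j _ => hs j).mul_left _)
  have : (p z).toReal - (Φ.outputE W z).toReal =
      (Φ.size : ℝ)⁻¹ * ∑ j, ((p z).toReal - (output W (Φ.Q j) z).toReal) := by
    rw [Φ.toReal_outputE, Finset.sum_sub_distrib, Finset.sum_const, Finset.card_univ,
      Fintype.card_fin, nsmul_eq_mul, mul_sub, inv_mul_cancel_left₀ (by positivity)]
  rw [this, abs_mul, abs_of_nonneg (by positivity)]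
  exact mul_le_mul_of_nonneg_left (Finset.abs_sum_le_sum_abs _ _) (by positivity)

/-- The average variational distance of the wire-tapper's conditional output distributions from
their mean. -/
noncomputable def Code.meanDistE (Φ : Code X Y) (W : Channel X Z) : ℝ :=
  (Φ.size : ℝ)⁻¹ * ∑ i, variationalDist (output W (Φ.Q i)) (Φ.outputE W)

lemma Code.distE_nonneg (Φ : Code X Y) (W : Channel X Z) : 0 ≤ Φ.distE W := by
  have hM := Φ.one_le_size
  refine mul_nonneg (inv_nonneg.2 (mul_nonneg (by linarith) (by linarith)))
    (Finset.sum_nonneg fun i _ => Finset.sum_nonneg fun j _ => ?_)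
  split_ifs
  · exact le_rfl
  · exact variationalDist_nonneg _ _

/-- By convexity the distance to the mean is at most the average over all M² pairs; the diagonal
vanishes and 1/M² ≤ 1/(M(M - 1)). -/
lemma Code.meanDistE_le (Φ : Code X Y) (W : Channel X Z) : Φ.meanDistE W ≤ Φ.distE W := by
  have hM := Φ.one_le_size
  set S := ∑ i, ∑ j, if i = j then 0
    else variationalDist (output W (Φ.Q i)) (output W (Φ.Q j)) with hS
  have hS0 : 0 ≤ S := Finset.sum_nonneg fun i _ => Finset.sum_nonneg fun j _ => by
    split_ifs
    · exact le_rfl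
    · exact variationalDist_nonneg _ _
  have h1 : Φ.meanDistE W ≤ ((Φ.size : ℝ) * Φ.size)⁻¹ * S := by
    rw [mul_inv, mul_assoc]
    refine mul_le_mul_of_nonneg_left ?_ (by positivity)
    rw [hS, Finset.mul_sum]
    refine Finset.sum_le_sum fun i _ => (Φ.variationalDist_outputE_le W _).trans_eq ?_
    congr 1
    refine Finset.sum_congr rfl fun j _ => ?_
    split_ifs with h
    · rw [h, variationalDist_self]
    · rfl
  rcases hM.eq_or_lt with h | h
  -- For M = 1 the comparison of inverses fails, since the inverse of 0 is 0, but the sum over pairs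
  -- is then zero.
  · have hsz : Φ.size = 1 := by exact_mod_cast h.symm
    have hS' : S = 0 := by
      refine Finset.sum_eq_zero fun i _ => Finset.sum_eq_zero fun j _ => if_pos ?_
      exact Fin.ext (by omega)
    rw [hS', mul_zero] at h1
    exact h1.trans (Φ.distE_nonneg W)
  · refine h1.trans (mul_le_mul_of_nonneg_right (inv_anti₀ ?_ ?_) hS0)
    · exact mul_pos (by linarith) (by linarith)
    · exact mul_le_mul_of_nonneg_left (by linarith) (by linarith)

lemma ereal_coe_sum {ι : Type*} (s : Finset ι) (f : ι → ℝ) :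
    ((∑ i ∈ s, f i : ℝ) : EReal) = ∑ i ∈ s, (f i : EReal) :=
  map_sum (⟨⟨(↑), EReal.coe_zero⟩, EReal.coe_add⟩ : ℝ →+ EReal) f s

/-- The wire-tapper's information as a real number. -/
noncomputable def Code.infoEReal (Φ : Code X Y) (W : Channel X Z) : ℝ :=
  (Φ.size : ℝ)⁻¹ * ∑ i, klSum (output W (Φ.Q i)) (Φ.outputE W)

lemma Code.infoE_eq (Φ : Code X Y) (W : Channel X Z) : Φ.infoE W = (Φ.infoEReal W : EReal) := by
  rw [Code.infoE, Code.infoEReal, Finset.mul_sum, ereal_coe_sum]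
  refine Finset.sum_congr rfl fun i _ => ?_
  rw [klDivergence_eq Φ.one_le_size (Φ.le_size_mul_outputE W i), EReal.coe_mul]

lemma Code.infoEReal_nonneg (Φ : Code X Y) (W : Channel X Z) : 0 ≤ Φ.infoEReal W :=
  mul_nonneg (by positivity) (Finset.sum_nonneg fun i _ =>
    klSum_nonneg Φ.one_le_size (Φ.le_size_mul_outputE W i))

lemma Code.infoEReal_le (Φ : Code X Y) (W : Channel X Z) :
    Φ.infoEReal W ≤ Φ.distE W * (1 + Real.log Φ.size) := by
  have hlog : 0 ≤ Real.log Φ.size := Real.log_nonneg Φ.one_le_size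
  refine le_trans ?_ (mul_le_mul_of_nonneg_right (Φ.meanDistE_le W) (by positivity))
  rw [Code.infoEReal, Code.meanDistE, mul_assoc, Finset.sum_mul]
  refine mul_le_mul_of_nonneg_left (Finset.sum_le_sum fun i _ => ?_) (by positivity)
  exact klSum_le Φ.one_le_size (Φ.le_size_mul_outputE W i)

lemma Code.toReal_exceedance (Φ : Code X Y) (W : Channel X Z) (c : ℝ≥0∞) :
    (exceedance Φ.uniformMessage (Φ.messageChannel W) c).toReal = (Φ.size : ℝ)⁻¹ *
      ∑ i, ((output W (Φ.Q i)).toOuterMeasure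
        {z | c * Φ.outputE W z < output W (Φ.Q i) z}).toReal := by
  rw [exceedance, tsum_fintype, ENNReal.toReal_sum, Finset.mul_sum]
  · simp only [Code.uniformMessage_apply, ENNReal.toReal_mul, ENNReal.toReal_inv,
      ENNReal.toReal_natCast]
    rfl
  · exact fun i _ => ENNReal.mul_ne_top (PMF.apply_ne_top _ _)
      ((toOuterMeasure_le_one _ _).trans_lt ENNReal.one_lt_top).ne

lemma Code.one_sub_inv_mul_exceedance_le (Φ : Code X Y) (W : Channel X Z) {c : ℝ} (hc : 0 < c) :
    (1 - c⁻¹) * (exceedance Φ.uniformMessage (Φ.messageChannel W) (ENNReal.ofReal c)).toReal ≤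
      Φ.distE W := by
  refine le_trans ?_ (Φ.meanDistE_le W)
  rw [Φ.toReal_exceedance, Code.meanDistE, mul_left_comm, Finset.mul_sum]
  exact mul_le_mul_of_nonneg_left (Finset.sum_le_sum fun i _ =>
    one_sub_inv_mul_toOuterMeasure_le _ _ hc) (by positivity)

lemma Code.log_mul_exceedance_le (Φ : Code X Y) (W : Channel X Z) {c : ℝ} (hc : 1 ≤ c) :
    Real.log c * (exceedance Φ.uniformMessage (Φ.messageChannel W) (ENNReal.ofReal c)).toReal ≤
      Φ.infoEReal W + 1 := by
  have hM := Φ.one_le_size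
  have h1 : (1 : ℝ) = (Φ.size : ℝ)⁻¹ * ∑ _i : Fin Φ.size, (1 : ℝ) := by
    simp [inv_mul_cancel₀ (by positivity : (Φ.size : ℝ) ≠ 0)]
  rw [Φ.toReal_exceedance, Code.infoEReal, h1, ← mul_add, mul_left_comm, Finset.mul_sum,
    ← Finset.sum_add_distrib]
  exact mul_le_mul_of_nonneg_left (Finset.sum_le_sum fun i _ =>
    log_mul_toOuterMeasure_le hM (Φ.le_size_mul_outputE W i) hc) (by positivity)

end Secrecy

/-! ### Random codebooks: channel resolvability -/

section RandomCoding

open MeasureTheory ProbabilityTheory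

variable {V : Type v} [MeasurableSpace V] {κ : Type*} [Fintype κ]

/-- The law of a family of independent codewords, each distributed according to `p`. -/
noncomputable abbrev codewordLaw (κ : Type*) [Fintype κ] (p : PMF V) : Measure (κ → V) :=
  Measure.pi fun _ => p.toMeasure

lemma indepFun_eval (p : PMF V) {k l : κ} (hkl : k ≠ l) :
    IndepFun (fun ω : κ → V => ω k) (fun ω => ω l) (codewordLaw κ p) :=
  (iIndepFun_pi (μ := fun _ : κ => p.toMeasure) (X := fun _ => id)
    fun _ => measurable_id.aemeasurable).indepFun hkl

variable [Countable V] [MeasurableSingletonClass V]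

lemma lintegral_toMeasure (p : PMF V) (g : V → ℝ≥0∞) :
    ∫⁻ v, g v ∂p.toMeasure = ∑' v, p v * g v := by
  rw [lintegral_countable']
  refine tsum_congr fun v => ?_
  rw [p.toMeasure_apply_singleton v (measurableSet_singleton v), mul_comm]

lemma lintegral_eval (p : PMF V) (k : κ) (g : V → ℝ≥0∞) :
    ∫⁻ ω, g (ω k) ∂codewordLaw κ p = ∑' v, p v * g v := by
  rw [← lintegral_toMeasure]
  exact (measurePreserving_eval (fun _ : κ => p.toMeasure) k).lintegral_comp
    (Measurable.of_discrete (f := g))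

lemma lintegral_eval_pair (p : PMF V) {k l : κ} (hkl : k ≠ l) (h : V → V → ℝ≥0∞) :
    ∫⁻ ω, h (ω k) (ω l) ∂codewordLaw κ p = ∑' v, p v * ∑' w, p w * h v w := by
  have hmap := (indepFun_iff_map_prod_eq_prod_map_map (measurable_pi_apply k).aemeasurable
    (measurable_pi_apply l).aemeasurable).1 (indepFun_eval p hkl)
  have hk := (measurePreserving_eval (fun _ : κ => p.toMeasure) k).map_eq
  have hl := (measurePreserving_eval (fun _ : κ => p.toMeasure) l).map_eq
  have hmap' : (codewordLaw κ p).map (fun ω => (ω k, ω l)) = p.toMeasure.prod p.toMeasure :=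
    hmap.trans (by congr 1)
  have hm : Measurable fun x : V × V => h x.1 x.2 := Measurable.of_discrete
  calc ∫⁻ ω, h (ω k) (ω l) ∂codewordLaw κ p
      = ∫⁻ x, h x.1 x.2 ∂(codewordLaw κ p).map (fun ω => (ω k, ω l)) :=
        (lintegral_map (g := fun ω : κ → V => (ω k, ω l)) hm
          ((measurable_pi_apply k).prodMk (measurable_pi_apply l))).symm
    _ = ∑' v, p v * ∑' w, p w * h v w := by
        rw [hmap', lintegral_prod _ hm.aemeasurable, lintegral_toMeasure]
        simp_rw [lintegral_toMeasure]

lemma memLp_of_bounded {Ω : Type*} [MeasurableSpace Ω] {μ : Measure Ω} [IsFiniteMeasure μ]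
    [DiscreteMeasurableSpace Ω] {f : Ω → ℝ} {K : ℝ} (hf : ∀ ω, |f ω| ≤ K) (r : ℝ≥0∞) :
    MemLp f r μ :=
  MemLp.of_bound (Measurable.of_discrete.aestronglyMeasurable) K (ae_of_all _ hf)

/-- The first absolute moment of the deviation is at most the square root of its variance, and
pairwise independence makes the variance of the mean at most 1/|s| times the second moment. -/
lemma lintegral_abs_mean_sub_le (p : PMF V) (s : Finset κ) (hs : s.Nonempty) {g : V → ℝ} {K : ℝ}
    (hg : ∀ v, |g v| ≤ K) :
    ∫⁻ ω, ENNReal.ofReal |(s.card : ℝ)⁻¹ * ∑ k ∈ s, g (ω k) - ∫ v, g v ∂p.toMeasure|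
        ∂codewordLaw κ p ≤
      ENNReal.ofReal √((s.card : ℝ)⁻¹ * ∫ v, g v ^ 2 ∂p.toMeasure) := by
  set μ := codewordLaw κ p
  set L : ℝ := (s.card : ℝ)
  have hL : 0 < L := by simpa [L] using hs
  have hev (k : κ) := measurePreserving_eval (fun _ : κ => p.toMeasure) k
  have hmem (k : κ) : MemLp (fun ω : κ → V => g (ω k)) 2 μ := memLp_of_bounded (fun ω => hg _) 2
  have hint (k : κ) : ∫ ω, g (ω k) ∂μ = ∫ v, g v ∂p.toMeasure := by
    rw [← (hev k).map_eq, integral_map (measurable_pi_apply k).aemeasurable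
      (Measurable.of_discrete.aestronglyMeasurable)]
  have hvar (k : κ) : Var[fun ω : κ → V => g (ω k); μ] ≤ ∫ v, g v ^ 2 ∂p.toMeasure := by
    refine (variance_le_expectation_sq (Measurable.of_discrete.aestronglyMeasurable)).trans_eq ?_
    rw [← (hev k).map_eq, integral_map (measurable_pi_apply k).aemeasurable
      (Measurable.of_discrete.aestronglyMeasurable)]
    rfl
  set S : (κ → V) → ℝ := ∑ k ∈ s, fun ω => g (ω k) with hS
  have hSmem : MemLp S 2 μ := memLp_finsetSum' s fun k _ => hmem k
  have hSvar : Var[S; μ] ≤ L * ∫ v, g v ^ 2 ∂p.toMeasure := by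
    rw [hS, IndepFun.variance_sum (fun k _ => hmem k)]
    · refine (Finset.sum_le_sum fun k _ => hvar k).trans_eq ?_
      simp [L]
    · intro k _ l _ hkl
      exact (indepFun_eval p hkl).comp (Measurable.of_discrete (f := g))
        (Measurable.of_discrete (f := g))
  set T : (κ → V) → ℝ := fun ω => L⁻¹ * S ω with hT
  have hTmem : MemLp T 2 μ := hSmem.const_mul _
  have hTint : μ[T] = ∫ v, g v ∂p.toMeasure := by
    have : μ[S] = L * ∫ v, g v ∂p.toMeasure := by
      simp only [hS, Finset.sum_apply]
      rw [integral_finsetSum _ fun k _ => (hmem k).integrable (by norm_num)]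
      simp [hint, L]
    rw [hT, integral_const_mul, this, inv_mul_cancel_left₀ hL.ne']
  have hTvar : Var[T; μ] ≤ L⁻¹ * ∫ v, g v ^ 2 ∂p.toMeasure := by
    rw [hT, variance_const_mul]
    calc L⁻¹ ^ 2 * Var[S; μ] ≤ L⁻¹ ^ 2 * (L * ∫ v, g v ^ 2 ∂p.toMeasure) :=
          mul_le_mul_of_nonneg_left hSvar (by positivity)
      _ = _ := by field_simp
  have hTS (ω : κ → V) : L⁻¹ * ∑ k ∈ s, g (ω k) = T ω := by simp [hT, hS]
  simp_rw [hTS]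
  have hDmem : MemLp (fun ω => |T ω - ∫ v, g v ∂p.toMeasure|) 2 μ :=
    (hTmem.sub (memLp_const _)).abs
  rw [← ofReal_integral_eq_lintegral_ofReal (hDmem.integrable (by norm_num))
    (ae_of_all _ fun _ => abs_nonneg _)]
  refine ENNReal.ofReal_le_ofReal (Real.le_sqrt_of_sq_le ?_)
  refine le_trans ?_ hTvar
  -- Nonnegativity of the variance of |T - E T| says (E|T - E T|)² ≤ Var T.
  have h1 := variance_nonneg (fun ω => |T ω - ∫ v, g v ∂p.toMeasure|) μ
  rw [variance_eq_sub hDmem] at h1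
  have h2 : Var[T; μ] = μ[(fun ω => |T ω - ∫ v, g v ∂p.toMeasure|) ^ 2] := by
    rw [variance_eq_integral hTmem.aemeasurable, hTint]
    simp
  rw [h2]
  linarith

variable {Z : Type u₂}

/-- Truncate E_v(z) = G + H at β m. The bounded part has second moment at most β m², giving √(β/L)
m; the excess H is not concentrated, and the triangle inequality charges its expectation twice, once
for the empirical mean and once for the true one. -/
lemma lintegral_abs_mean_sub_output_le (p : PMF V) (E : Channel V Z) (s : Finset κ)
    (hs : s.Nonempty) {β : ℝ} (hβ : 0 ≤ β) (z : Z) :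
    ∫⁻ ω, ENNReal.ofReal |(s.card : ℝ)⁻¹ * ∑ k ∈ s, (E (ω k) z).toReal - (output E p z).toReal|
        ∂codewordLaw κ p ≤
      ENNReal.ofReal √(β / s.card) * output E p z +
        2 * ∑' v, p v * {z | ENNReal.ofReal β * output E p z < E v z}.indicator (E v) z := by
  classical
  set m := output E p z with hm
  obtain ⟨G, hG⟩ : ∃ G : V → ℝ≥0∞, G = fun v => if ENNReal.ofReal β * m < E v z then 0 else E v z :=
    ⟨_, rfl⟩
  obtain ⟨H, hH⟩ : ∃ H : V → ℝ≥0∞, H = fun v => if ENNReal.ofReal β * m < E v z then E v z else 0 :=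
    ⟨_, rfl⟩
  have hGle (v : V) : G v ≤ E v z := by simp only [hG]; split_ifs <;> simp
  have hHle (v : V) : H v ≤ E v z := by simp only [hH]; split_ifs <;> simp
  have hG1 (v : V) : G v ≤ 1 := (hGle v).trans (PMF.coe_le_one _ _)
  have hH1 (v : V) : H v ≤ 1 := (hHle v).trans (PMF.coe_le_one _ _)
  have hGtop (v : V) : G v ≠ ⊤ := ((hG1 v).trans_lt ENNReal.one_lt_top).ne
  have hHtop (v : V) : H v ≠ ⊤ := ((hH1 v).trans_lt ENNReal.one_lt_top).ne
  have hGH (v : V) : E v z = G v + H v := by simp only [hG, hH]; split_ifs <;> simp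
  have hmtop : m ≠ ⊤ := PMF.apply_ne_top _ _
  set L : ℝ := (s.card : ℝ)
  have hL : 0 < L := by simpa [L] using hs
  have hL' : 0 ≤ L⁻¹ := (inv_pos.2 hL).le
  set g : V → ℝ := fun v => (G v).toReal
  have hg0 (v : V) : 0 ≤ g v := ENNReal.toReal_nonneg
  have hgabs (v : V) : |g v| ≤ 1 := by
    rw [abs_of_nonneg (hg0 v)]
    exact ENNReal.toReal_le_of_le_ofReal zero_le_one (by simpa using hG1 v)
  have hgβ (v : V) : g v ≤ β * m.toReal := by
    refine ENNReal.toReal_le_of_le_ofReal (by positivity) ?_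
    rw [ENNReal.ofReal_mul hβ, ENNReal.ofReal_toReal hmtop]
    simp only [hG]; split_ifs with h
    · exact zero_le
    · exact not_lt.1 h
  set eG := ∑' v, p v * G v with heG
  set eH := ∑' v, p v * H v with heH
  have hsum : m = eG + eH := by
    rw [hm, output_apply, heG, heH, ← ENNReal.tsum_add]
    simp_rw [← mul_add, ← hGH]
  have heGtop : eG ≠ ⊤ := fun h => hmtop (by simp [hsum, h])
  have heHtop : eH ≠ ⊤ := fun h => hmtop (by simp [hsum, h])
  have hintg : ∫ v, g v ∂p.toMeasure = eG.toReal := by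
    rw [heG, ← lintegral_toMeasure]
    exact integral_toReal Measurable.of_discrete.aemeasurable
      (ae_of_all _ fun v => (hGtop v).lt_top)
  have hgint : Integrable g p.toMeasure :=
    (memLp_of_bounded hgabs 1).integrable le_rfl
  have hg2 : ∫ v, g v ^ 2 ∂p.toMeasure ≤ β * m.toReal ^ 2 := by
    calc ∫ v, g v ^ 2 ∂p.toMeasure ≤ ∫ v, β * m.toReal * g v ∂p.toMeasure := by
          refine integral_mono ?_ (hgint.const_mul _) fun v => ?_
          · refine (memLp_of_bounded (K := 1) (fun v => ?_) 1).integrable le_rfl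
            rw [abs_pow]
            exact pow_le_one₀ (abs_nonneg _) (hgabs v)
          · simp only [pow_two]
            exact mul_le_mul_of_nonneg_right (hgβ v) (hg0 v)
      _ = β * m.toReal * eG.toReal := by rw [integral_const_mul, hintg]
      _ ≤ β * m.toReal * m.toReal := by
          refine mul_le_mul_of_nonneg_left (ENNReal.toReal_mono hmtop ?_) (by positivity)
          rw [hsum]; exact le_self_add
      _ = _ := by ring
  have hdev := lintegral_abs_mean_sub_le (κ := κ) p s hs hgabs
  have hpt (ω : κ → V) :
      ENNReal.ofReal |L⁻¹ * ∑ k ∈ s, (E (ω k) z).toReal - m.toReal| ≤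
        ENNReal.ofReal |L⁻¹ * ∑ k ∈ s, g (ω k) - ∫ v, g v ∂p.toMeasure| +
          ((s.card : ℝ≥0∞)⁻¹ * ∑ k ∈ s, H (ω k) + eH) := by
    have hHsum : ((s.card : ℝ≥0∞)⁻¹ * ∑ k ∈ s, H (ω k) + eH) =
        ENNReal.ofReal (L⁻¹ * ∑ k ∈ s, (H (ω k)).toReal + eH.toReal) := by
      rw [ENNReal.ofReal_add (mul_nonneg hL'
          (Finset.sum_nonneg fun _ _ => ENNReal.toReal_nonneg)) ENNReal.toReal_nonneg,
        ENNReal.ofReal_toReal heHtop, ENNReal.ofReal_mul hL',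
        ENNReal.ofReal_inv_of_pos hL, ENNReal.ofReal_natCast,
        ENNReal.ofReal_sum_of_nonneg fun _ _ => ENNReal.toReal_nonneg]
      simp_rw [ENNReal.ofReal_toReal (hHtop _)]
    rw [hHsum, ← ENNReal.ofReal_add (abs_nonneg _) (add_nonneg (mul_nonneg hL'
      (Finset.sum_nonneg fun _ _ => ENNReal.toReal_nonneg)) ENNReal.toReal_nonneg)]
    refine ENNReal.ofReal_le_ofReal ?_
    have hE (k : κ) : (E (ω k) z).toReal = g (ω k) + (H (ω k)).toReal := by
      rw [hGH, ENNReal.toReal_add (hGtop _) (hHtop _)]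
    have hm' : m.toReal = eG.toReal + eH.toReal := by
      rw [hsum, ENNReal.toReal_add heGtop heHtop]
    simp_rw [hE]
    rw [hintg, hm', Finset.sum_add_distrib, mul_add]
    set a := L⁻¹ * ∑ k ∈ s, g (ω k)
    set b := L⁻¹ * ∑ k ∈ s, (H (ω k)).toReal with hb
    have hb0 : 0 ≤ b := mul_nonneg hL'
      (Finset.sum_nonneg fun _ _ => ENNReal.toReal_nonneg)
    have he0 : 0 ≤ eH.toReal := ENNReal.toReal_nonneg
    have h1 := le_abs_self (a - eG.toReal)
    have h2 := neg_abs_le (a - eG.toReal)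
    exact abs_le.2 ⟨by linarith, by linarith⟩
  refine (lintegral_mono hpt).trans ?_
  rw [lintegral_add_left Measurable.of_discrete, lintegral_add_right _ measurable_const,
    lintegral_const, measure_univ, mul_one, lintegral_const_mul _ Measurable.of_discrete,
    lintegral_finsetSum _ fun _ _ => Measurable.of_discrete]
  simp_rw [lintegral_eval]
  rw [Finset.sum_const, nsmul_eq_mul, ← mul_assoc, ENNReal.inv_mul_cancel (by simpa using hs.ne_empty)
    (ENNReal.natCast_ne_top _), one_mul, ← two_mul]
  refine add_le_add (hdev.trans ?_) (le_of_eq ?_)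
  · change _ ≤ ENNReal.ofReal √(β / L) * m
    rw [← ENNReal.ofReal_toReal hmtop]
    rw [← ENNReal.ofReal_mul (Real.sqrt_nonneg _)]
    refine ENNReal.ofReal_le_ofReal ?_
    calc √(L⁻¹ * ∫ v, g v ^ 2 ∂p.toMeasure) ≤ √(β / L * m.toReal ^ 2) := by
          refine Real.sqrt_le_sqrt ?_
          rw [div_mul_eq_mul_div, ← inv_mul_eq_div]
          exact mul_le_mul_of_nonneg_left hg2 hL'
      _ = _ := by rw [Real.sqrt_mul (div_nonneg hβ hL.le), Real.sqrt_sq ENNReal.toReal_nonneg]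
  · simp only [hH, Set.indicator_apply]
    rfl

/-- Z may be uncountable, but Ω is countable, so the integral is itself a sum and two sums of
nonnegative terms commute. -/
lemma lintegral_tsum_comm {Ω : Type*} [Countable Ω] [MeasurableSpace Ω]
    [MeasurableSingletonClass Ω] (μ : Measure Ω) (f : Ω → Z → ℝ≥0∞) :
    ∫⁻ ω, ∑' z, f ω z ∂μ = ∑' z, ∫⁻ ω, f ω z ∂μ := by
  simp_rw [lintegral_countable', ← ENNReal.tsum_mul_right]
  exact ENNReal.tsum_comm

/-- Averaged over the codewords, the output distribution of a uniformly chosen codeword is close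
to the output distribution of `p`. -/
lemma lintegral_tsum_abs_mean_sub_output_le (p : PMF V) (E : Channel V Z) (s : Finset κ)
    (hs : s.Nonempty) {β : ℝ} (hβ : 0 ≤ β) :
    ∫⁻ ω, ∑' z, ENNReal.ofReal
          |(s.card : ℝ)⁻¹ * ∑ k ∈ s, (E (ω k) z).toReal - (output E p z).toReal|
        ∂codewordLaw κ p ≤
      ENNReal.ofReal √(β / s.card) + 2 * exceedance p E (ENNReal.ofReal β) := by
  rw [lintegral_tsum_comm]
  refine (ENNReal.tsum_le_tsum fun z =>
    lintegral_abs_mean_sub_output_le p E s hs hβ z).trans_eq ?_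
  rw [ENNReal.tsum_add, ENNReal.tsum_mul_left, ENNReal.tsum_mul_left, PMF.tsum_coe, mul_one,
    ENNReal.tsum_comm]
  congr 2
  refine tsum_congr fun v => ?_
  rw [ENNReal.tsum_mul_left, toOuterMeasure_eq_sum_indicator]

end RandomCoding

/-! ### The random wire-tap code and its mean performance -/

section RandomCode

open MeasureTheory ProbabilityTheory

variable {X : Type u} {V : Type v} {Y : Type u₁} {Z : Type u₂}

/-- Triangle inequality through q: each index occurs in 2(M - 1) ordered off-diagonal pairs. -/
lemma Code.distE_le (Φ : Code X Y) (W : Channel X Z) (q : PMF Z) :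
    Φ.distE W ≤ 2 * ((Φ.size : ℝ)⁻¹ * ∑ i, variationalDist (output W (Φ.Q i)) q) := by
  have hM := Φ.one_le_size
  set a : Fin Φ.size → ℝ := fun i => variationalDist (output W (Φ.Q i)) q with ha
  have ha0 (i : Fin Φ.size) : 0 ≤ a i := variationalDist_nonneg _ _
  have h1 : (∑ i, ∑ j, if i = j then 0
      else variationalDist (output W (Φ.Q i)) (output W (Φ.Q j))) ≤
      2 * (Φ.size - 1 : ℝ) * ∑ i, a i := by
    calc (∑ i, ∑ j, if i = j then 0
          else variationalDist (output W (Φ.Q i)) (output W (Φ.Q j)))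
        ≤ ∑ i, ∑ j, ((a i + a j) - if i = j then 2 * a i else 0) := by
          refine Finset.sum_le_sum fun i _ => Finset.sum_le_sum fun j _ => ?_
          split_ifs with h
          · subst h; linarith
          · have := variationalDist_triangle (output W (Φ.Q i)) q (output W (Φ.Q j))
            rw [variationalDist_comm q] at this
            simpa [ha] using this
      _ = 2 * (Φ.size - 1 : ℝ) * ∑ i, a i := by
          simp only [Finset.sum_sub_distrib, Finset.sum_add_distrib, Finset.sum_ite_eq,
            Finset.mem_univ, if_true, Finset.sum_const, Finset.card_univ, Fintype.card_fin,
            nsmul_eq_mul, ← Finset.mul_sum]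
          ring
  have hS : 0 ≤ ∑ i, a i := Finset.sum_nonneg fun i _ => ha0 i
  have hinv : 0 ≤ ((Φ.size : ℝ) * (Φ.size - 1))⁻¹ :=
    inv_nonneg.2 (mul_nonneg (by linarith) (by linarith))
  refine (mul_le_mul_of_nonneg_left h1 hinv).trans ?_
  rcases hM.eq_or_lt with h | h
  · rw [← h]; simp only [sub_self, mul_zero, inv_zero, zero_mul, inv_one, one_mul]; positivity
  · have : (Φ.size : ℝ) - 1 ≠ 0 := by linarith
    have : (Φ.size : ℝ) ≠ 0 := by linarith
    refine le_of_eq ?_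
    field_simp

/-- The code with codebook `ω`: message `i` is sent by a uniformly chosen codeword `ω (i, j)`, and
the receiver decides for `i` if only codewords of `i` pass the likelihood test with threshold
`α`. -/
noncomputable def codeOfCodebook {M L : ℕ} [NeZero M] [NeZero L] (r : PMF Y) (B : Channel V Y)
    (α : ℝ≥0∞) (ω : Fin M × Fin L → V) : Code V Y where
  size := M
  size_pos := NeZero.pos M
  Q i := (PMF.uniformOfFintype (Fin L)).map fun j => ω (i, j)
  D i := {y | (∃ j, α * r y < B (ω (i, j)) y) ∧
    ∀ k : Fin M × Fin L, k.1 ≠ i → B (ω k) y ≤ α * r y}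
  disjoint i j hij := by
    refine Set.disjoint_left.2 fun y hy hy' => ?_
    obtain ⟨k, hk⟩ := hy.1
    exact not_le.2 hk (hy'.2 (i, k) hij)

variable {M L : ℕ} [NeZero M] [NeZero L]

lemma output_codeOfCodebook_apply (r : PMF Y) (B : Channel V Y) (α : ℝ≥0∞)
    (ω : Fin M × Fin L → V) (W : Channel V Z) (i : Fin M) (z : Z) :
    output W ((codeOfCodebook r B α ω).Q i) z = (L : ℝ≥0∞)⁻¹ * ∑ j, W (ω (i, j)) z := by
  change output W ((PMF.uniformOfFintype (Fin L)).map fun j => ω (i, j)) z = _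
  rw [output_map, output_apply, tsum_fintype, Finset.mul_sum]
  simp [PMF.uniformOfFintype_apply]

/-- Union bound: an error requires that the sent codeword fails the test or that another one passes.
Codewords of the same message are counted too, which only enlarges the bound. -/
lemma errorB_codeOfCodebook_le (r : PMF Y) (B : Channel V Y) (α : ℝ≥0∞)
    (ω : Fin M × Fin L → V) :
    (codeOfCodebook r B α ω).errorB B ≤ ((M : ℝ≥0∞) * L)⁻¹ * ∑ k : Fin M × Fin L,
      ((B (ω k)).toOuterMeasure {y | B (ω k) y ≤ α * r y} +
        ∑ l ∈ Finset.univ.erase k, (B (ω k)).toOuterMeasure {y | α * r y < B (ω l) y}) := by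
  classical
  set Φ := codeOfCodebook r B α ω with hΦ
  have hout (i : Fin M) (s : Set Y) : (output B (Φ.Q i)).toOuterMeasure s =
      (L : ℝ≥0∞)⁻¹ * ∑ j, (B (ω (i, j))).toOuterMeasure s := by
    change (output B ((PMF.uniformOfFintype (Fin L)).map fun j => ω (i, j))).toOuterMeasure s = _
    rw [output_map, toOuterMeasure_output, tsum_fintype, Finset.mul_sum]
    simp [PMF.uniformOfFintype_apply]
  have herr : Φ.errorB B = ((M : ℝ≥0∞) * L)⁻¹ *
      ∑ k : Fin M × Fin L, (B (ω k)).toOuterMeasure (Φ.D k.1)ᶜ := by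
    rw [Code.errorB, ENNReal.div_eq_inv_mul, Fintype.sum_prod_type,
      ENNReal.mul_inv (Or.inr (ENNReal.natCast_ne_top _)) (Or.inl (ENNReal.natCast_ne_top _)),
      mul_assoc]
    congr 1
    rw [Finset.mul_sum]
    exact Finset.sum_congr rfl fun i _ => hout i _
  rw [herr]
  refine mul_le_mul_right (Finset.sum_le_sum fun k _ => ?_) _
  have hsub : (Φ.D k.1)ᶜ ⊆ {y | B (ω k) y ≤ α * r y} ∪
      ⋃ l ∈ Finset.univ.erase k, {y | α * r y < B (ω l) y} := by
    intro y hy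
    by_contra hcon
    simp only [Set.mem_union, Set.mem_ofPred_eq, Set.mem_iUnion, Finset.mem_erase,
      Finset.mem_univ, and_true, not_or, not_exists, not_le, not_lt] at hcon
    refine hy ⟨⟨k.2, hcon.1⟩, fun l hl => hcon.2 l ?_⟩
    rintro rfl
    exact hl rfl
  exact (measure_mono hsub).trans ((measure_union_le _ _).trans
    (add_le_add_right (measure_biUnion_finset_le _ _) _))

lemma ofReal_distE_codeOfCodebook_le (r : PMF Y) (B : Channel V Y) (α : ℝ≥0∞)
    (ω : Fin M × Fin L → V) (E : Channel V Z) (q : PMF Z) :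
    ENNReal.ofReal ((codeOfCodebook r B α ω).distE E) ≤
      2 * ((M : ℝ≥0∞)⁻¹ * ∑ i : Fin M, ∑' z, ENNReal.ofReal
        |(L : ℝ)⁻¹ * ∑ j, (E (ω (i, j)) z).toReal - (q z).toReal|) := by
  have hM : (0 : ℝ) < M := by exact_mod_cast NeZero.pos M
  refine (ENNReal.ofReal_le_ofReal (Code.distE_le _ E q)).trans_eq ?_
  change ENNReal.ofReal (2 * ((M : ℝ)⁻¹ * ∑ i : Fin M,
    variationalDist (output E ((codeOfCodebook r B α ω).Q i)) q)) = _
  rw [ENNReal.ofReal_mul zero_le_two, ENNReal.ofReal_mul (by positivity),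
    ENNReal.ofReal_inv_of_pos hM, ENNReal.ofReal_natCast,
    ENNReal.ofReal_sum_of_nonneg fun _ _ => variationalDist_nonneg _ _]
  rw [ENNReal.ofReal_ofNat]
  refine congrArg (fun x => 2 * ((M : ℝ≥0∞)⁻¹ * x)) (Finset.sum_congr rfl fun i _ => ?_)
  rw [ofReal_variationalDist]
  refine tsum_congr fun z => ?_
  rw [output_codeOfCodebook_apply, ENNReal.toReal_mul,
    ENNReal.toReal_sum fun _ _ => PMF.apply_ne_top _ _]
  simp

variable [MeasurableSpace V] [Countable V] [MeasurableSingletonClass V]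

/-- Fix the wrong codeword w. Averaging over the independent sent codeword turns its output law into
the output law of p, which is at most α⁻¹ B_w on the set where w passes. -/
lemma lintegral_confusion_le (p : PMF V) (B : Channel V Y) (α : ℝ≥0∞) {κ : Type*} [Fintype κ]
    {k l : κ} (hkl : k ≠ l) :
    ∫⁻ ω, (B (ω k)).toOuterMeasure {y | α * output B p y < B (ω l) y} ∂codewordLaw κ p ≤
      α⁻¹ := by
  rw [lintegral_eval_pair p hkl.symm fun w v =>
    (B v).toOuterMeasure {y | α * output B p y < B w y}]
  have h (w : V) : ∑' v, p v * (B v).toOuterMeasure {y | α * output B p y < B w y} ≤ α⁻¹ := by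
    rw [← toOuterMeasure_output]
    refine (toOuterMeasure_le_of_forall _ (B w) _ α⁻¹ fun y hy => ?_).trans
      ((mul_le_mul_right (toOuterMeasure_le_one _ _) _).trans (mul_one _).le)
    rw [← ENNReal.div_eq_inv_mul]
    have hy' : α * output B p y < B w y := hy
    refine ENNReal.le_div_iff_mul_le (Or.inr ?_) (Or.inr (PMF.apply_ne_top _ _)) |>.2 ?_
    · exact (zero_le.trans_lt hy').ne'
    · rw [mul_comm]; exact hy'.le
  calc _ ≤ ∑' w, p w * α⁻¹ := ENNReal.tsum_le_tsum fun w => mul_le_mul_right (h w) _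
    _ = α⁻¹ := by rw [ENNReal.tsum_mul_right, p.tsum_coe, one_mul]

lemma lintegral_errorB_le (p : PMF V) (B : Channel V Y) (α : ℝ≥0∞) :
    ∫⁻ ω : Fin M × Fin L → V, (codeOfCodebook (output B p) B α ω).errorB B ∂codewordLaw _ p ≤
      shortfall p B α + M * L / α := by
  refine (lintegral_mono fun ω => errorB_codeOfCodebook_le (output B p) B α ω).trans ?_
  rw [lintegral_const_mul _ Measurable.of_discrete,
    lintegral_finsetSum _ fun _ _ => Measurable.of_discrete]
  have hML : ((M : ℝ≥0∞) * L) ≠ 0 := mul_ne_zero (by simp [NeZero.ne]) (by simp [NeZero.ne])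
  have hML' : ((M : ℝ≥0∞) * L) ≠ ⊤ :=
    ENNReal.mul_ne_top (ENNReal.natCast_ne_top _) (ENNReal.natCast_ne_top _)
  have hk (k : Fin M × Fin L) : ∫⁻ ω : Fin M × Fin L → V,
      ((B (ω k)).toOuterMeasure {y | B (ω k) y ≤ α * output B p y} +
        ∑ l ∈ Finset.univ.erase k,
          (B (ω k)).toOuterMeasure {y | α * output B p y < B (ω l) y}) ∂codewordLaw _ p ≤
      shortfall p B α + M * L / α := by
    rw [lintegral_add_left Measurable.of_discrete,
      lintegral_finsetSum _ fun _ _ => Measurable.of_discrete]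
    refine add_le_add (lintegral_eval p k fun v =>
      (B v).toOuterMeasure {y | B v y ≤ α * output B p y}).le ?_
    refine (Finset.sum_le_sum fun l hl =>
      lintegral_confusion_le p B α (Finset.ne_of_mem_erase hl).symm).trans ?_
    rw [Finset.sum_const, nsmul_eq_mul, div_eq_mul_inv]
    refine mul_le_mul_left ?_ _
    have : (Finset.univ.erase k).card ≤ M * L :=
      (Finset.card_le_univ _).trans_eq (by simp)
    exact_mod_cast this
  refine (mul_le_mul_right (Finset.sum_le_sum fun k _ => hk k) _).trans_eq ?_
  rw [Finset.sum_const, Finset.card_univ, Fintype.card_prod, Fintype.card_fin, Fintype.card_fin,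
    nsmul_eq_mul, Nat.cast_mul, ← mul_assoc, ENNReal.inv_mul_cancel hML hML', one_mul]

lemma lintegral_distE_le (p : PMF V) (r : PMF Y) (B : Channel V Y) (α : ℝ≥0∞) (E : Channel V Z)
    {β : ℝ} (hβ : 0 ≤ β) :
    ∫⁻ ω : Fin M × Fin L → V, ENNReal.ofReal ((codeOfCodebook r B α ω).distE E)
        ∂codewordLaw _ p ≤
      2 * (ENNReal.ofReal √(β / L) + 2 * exceedance p E (ENNReal.ofReal β)) := by
  classical
  refine (lintegral_mono fun ω =>
    ofReal_distE_codeOfCodebook_le r B α ω E (output E p)).trans ?_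
  rw [lintegral_const_mul _ Measurable.of_discrete, lintegral_const_mul _ Measurable.of_discrete,
    lintegral_finsetSum _ fun _ _ => Measurable.of_discrete]
  refine mul_le_mul_right ?_ _
  have hi (i : Fin M) : ∫⁻ ω : Fin M × Fin L → V, ∑' z, ENNReal.ofReal
        |(L : ℝ)⁻¹ * ∑ j, (E (ω (i, j)) z).toReal - (output E p z).toReal| ∂codewordLaw _ p ≤
      ENNReal.ofReal √(β / L) + 2 * exceedance p E (ENNReal.ofReal β) := by
    let e : Fin L ↪ Fin M × Fin L := ⟨Prod.mk i, Prod.mk_right_injective i⟩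
    have := lintegral_tsum_abs_mean_sub_output_le p E (Finset.univ.map e)
      (Finset.univ_nonempty.map) hβ
    simp only [Finset.sum_map, Finset.card_map, Finset.card_univ, Fintype.card_fin] at this
    exact this
  refine (mul_le_mul_right (Finset.sum_le_sum fun i _ => hi i) _).trans_eq ?_
  rw [Finset.sum_const, Finset.card_univ, Fintype.card_fin, nsmul_eq_mul, ← mul_assoc,
    ENNReal.inv_mul_cancel (by simp [NeZero.ne]) (ENNReal.natCast_ne_top _), one_mul]

end RandomCode

/-! ### Non-asymptotic coding theorem -/

section SingleShot

open MeasureTheory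

variable {V : Type v} {X : Type u} {Y : Type u₁} {Z : Type u₂}

/-- The code obtained by passing the inputs of a code through a channel. -/
noncomputable def Code.precode (Φ : Code V Y) (Q : Channel V X) : Code X Y where
  size := Φ.size
  size_pos := Φ.size_pos
  Q i := output Q (Φ.Q i)
  D := Φ.D
  disjoint := Φ.disjoint

lemma output_output (W : Channel X Z) (Q : Channel V X) (p : PMF V) :
    output W (output Q p) = output (cascade W Q) p := PMF.bind_bind _ _ _

lemma Code.errorB_precode (Φ : Code V Y) (Q : Channel V X) (W : Channel X Y) :
    (Φ.precode Q).errorB W = Φ.errorB (cascade W Q) := by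
  simp only [Code.errorB, Code.precode, output_output]
  rfl

lemma Code.distE_precode (Φ : Code V Y) (Q : Channel V X) (W : Channel X Z) :
    (Φ.precode Q).distE W = Φ.distE (cascade W Q) := by
  simp only [Code.distE, Code.precode, output_output]
  rfl

/-- Bounding the sum of the two criteria lets one codebook, no worse than the mean, be good for
both. -/
lemma exists_code_of_countable [Countable V] (p : PMF V) (B : Channel V Y) (E : Channel V Z)
    {M L : ℕ} (hM : 0 < M) (hL : 0 < L) (α : ℝ≥0∞) {β : ℝ} (hβ : 0 ≤ β) :
    ∃ Φ : Code V Y, Φ.size = M ∧ Φ.errorB B + ENNReal.ofReal (Φ.distE E) ≤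
      shortfall p B α + M * L / α +
        2 * (ENNReal.ofReal √(β / L) + 2 * exceedance p E (ENNReal.ofReal β)) := by
  let _ : MeasurableSpace V := ⊤
  have : NeZero M := ⟨hM.ne'⟩
  have : NeZero L := ⟨hL.ne'⟩
  obtain ⟨ω, hω⟩ := exists_le_lintegral (μ := codewordLaw (Fin M × Fin L) p)
    (f := fun ω => (codeOfCodebook (output B p) B α ω).errorB B +
      ENNReal.ofReal ((codeOfCodebook (output B p) B α ω).distE E))
    Measurable.of_discrete.aemeasurable
  refine ⟨codeOfCodebook (output B p) B α ω, rfl, hω.trans ?_⟩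
  rw [lintegral_add_left Measurable.of_discrete]
  exact add_le_add (lintegral_errorB_le p B α) (lintegral_distE_le p _ B α E hβ)

/-- The non-asymptotic direct part of the wire-tap channel coding theorem. -/
lemma exists_code (p : PMF V) (Q : Channel V X) (WB : Channel X Y) (WE : Channel X Z)
    {M L : ℕ} (hM : 0 < M) (hL : 0 < L) (α : ℝ≥0∞) {β : ℝ} (hβ : 0 ≤ β) :
    ∃ Φ : Code X Y, Φ.size = M ∧ Φ.errorB WB + ENNReal.ofReal (Φ.distE WE) ≤
      shortfall p (cascade WB Q) α + M * L / α +
        2 * (ENNReal.ofReal √(β / L) +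
          2 * exceedance p (cascade WE Q) (ENNReal.ofReal β)) := by
  obtain ⟨S, _, q, rfl⟩ := exists_countable_map_eq p
  obtain ⟨Φ, hsize, hΦ⟩ := exists_code_of_countable q (cascade WB Q ∘ Subtype.val)
    (cascade WE Q ∘ Subtype.val) hM hL α hβ
  refine ⟨Φ.precode (Q ∘ Subtype.val), hsize, ?_⟩
  rw [Code.errorB_precode, Code.distE_precode, shortfall_map, exceedance_map]
  exact hΦ

end SingleShot

/-! ### Converse part -/

section Converse

variable {X : ℕ → Type u} {Y : ℕ → Type u₁} {Z : ℕ → Type u₂}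

lemma upperI_zero_nonpos {p : ∀ n, PMF (X n)} {W : ∀ n, Channel (X n) (Y n)}
    (h : ∀ a : ℝ, 0 < a → Tendsto (fun n => spectrumTail n (p n) (W n) a) atTop (𝓝 0)) :
    upperI 0 p W ≤ 0 := by
  refine le_of_forall_gt_imp_ge_of_dense fun c hc => ?_
  obtain ⟨a, ha0, hac⟩ := EReal.lt_iff_exists_real_btwn.1 hc
  suffices h0 : upperI 0 p W ≤ a from h0.trans hac.le
  refine sInf_le ⟨a, rfl, ?_⟩
  rw [if_neg zero_ne_one, (h a (by exact_mod_cast ha0)).limsup_eq]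

lemma infoE_div_eq {A : Type u} {B : Type u₁} {C : Type u₂} (Φ : Code A B) (W : Channel A C)
    (n : ℕ) : Φ.infoE W / (((n : ℝ)) : EReal) = ((Φ.infoEReal W / n : ℝ) : EReal) := by
  rw [Φ.infoE_eq, EReal.coe_div]

variable {WB : ∀ n, Channel (X n) (Y n)} {WE : ∀ n, Channel (X n) (Z n)}
  {Φ : ∀ n, Code (X n) (Y n)}

lemma exceedance_ne_top {A : Type u} {B : Type u₁} (p : PMF A) (W : Channel A B) (c : ℝ≥0∞) :
    exceedance p W c ≠ ⊤ := ((exceedance_le_one p W c).trans_lt ENNReal.one_lt_top).ne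

lemma tendsto_exceedance_of_distE (h : Tendsto (fun n => (Φ n).distE (WE n)) atTop (𝓝 0))
    {a : ℝ} (ha : 0 < a) :
    Tendsto (fun n : ℕ => exceedance (Φ n).uniformMessage ((Φ n).messageChannel (WE n))
      (ENNReal.ofReal (Real.exp (n * a)))) atTop (𝓝 0) := by
  rw [← ENNReal.tendsto_toReal_zero_iff fun n => exceedance_ne_top _ _ _]
  -- For n ≥ 1 the factor 1 - e^{-na} is at least this constant.
  have hκ : 0 < 1 - Real.exp (-a) := by
    rw [sub_pos, Real.exp_lt_one_iff]; linarith
  refine squeeze_zero' (Eventually.of_forall fun n => ENNReal.toReal_nonneg) ?_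
    (by simpa using h.div_const (1 - Real.exp (-a)))
  filter_upwards [eventually_ge_atTop 1] with n hn
  have hn' : (1 : ℝ) ≤ n := by exact_mod_cast hn
  rw [le_div_iff₀ hκ, mul_comm]
  refine le_trans (mul_le_mul_of_nonneg_right ?_ ENNReal.toReal_nonneg)
    ((Φ n).one_sub_inv_mul_exceedance_le (WE n) (Real.exp_pos _))
  rw [← Real.exp_neg]
  refine sub_le_sub_left (Real.exp_le_exp.2 ?_) _
  nlinarith

lemma tendsto_exceedance_of_infoE
    (h : Tendsto (fun n : ℕ => (Φ n).infoE (WE n) / (((n : ℝ)) : EReal)) atTop (𝓝 0))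
    {a : ℝ} (ha : 0 < a) :
    Tendsto (fun n : ℕ => exceedance (Φ n).uniformMessage ((Φ n).messageChannel (WE n))
      (ENNReal.ofReal (Real.exp (n * a)))) atTop (𝓝 0) := by
  rw [← ENNReal.tendsto_toReal_zero_iff fun n => exceedance_ne_top _ _ _]
  simp_rw [infoE_div_eq] at h
  have h' : Tendsto (fun n : ℕ => (Φ n).infoEReal (WE n) / n) atTop (𝓝 0) := by
    rw [← EReal.coe_zero] at h
    exact EReal.tendsto_coe.1 h
  have hlim := (h'.add tendsto_one_div_atTop_nhds_zero_nat).div_const a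
  rw [add_zero, zero_div] at hlim
  refine squeeze_zero' (Eventually.of_forall fun n => ENNReal.toReal_nonneg) ?_ hlim
  filter_upwards [eventually_ge_atTop 1] with n hn
  have hn' : (0 : ℝ) < n := by exact_mod_cast hn
  have := (Φ n).log_mul_exceedance_le (WE n) (Real.one_le_exp (by positivity : 0 ≤ n * a))
  rw [Real.log_exp] at this
  rw [← add_div, div_div, le_div_iff₀ (by positivity), mul_comm]
  exact this

/-- If the rate exceeded some r > a, then eventually M ≥ e^{nr}, so the shortfall at e^{na} would be
at most the error plus e^{-n(r-a)}, and the exceedance would tend to 1. -/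
lemma rate_le_of_liminf_exceedance_lt
    (hB : Tendsto (fun n => (Φ n).errorB (WB n)) atTop (𝓝 0)) {a : ℝ}
    (ha : liminf (fun n : ℕ => exceedance (Φ n).uniformMessage ((Φ n).messageChannel (WB n))
      (ENNReal.ofReal (Real.exp (n * a)))) atTop < 1) : rate Φ ≤ a := by
  by_contra! hcon
  obtain ⟨r, har, hr⟩ := EReal.lt_iff_exists_real_btwn.1 hcon
  have har' : 0 < r - a := sub_pos.2 (by exact_mod_cast har)
  have hev := eventually_lt_of_lt_liminf hr
  refine not_le.2 ha ?_
  have hexp : Tendsto (fun n : ℕ => ENNReal.ofReal (Real.exp (-(n * (r - a))))) atTop (𝓝 0) := by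
    rw [← ENNReal.ofReal_zero]
    refine ENNReal.tendsto_ofReal (Real.tendsto_exp_atBot.comp ?_)
    exact tendsto_neg_atTop_atBot.comp (tendsto_natCast_atTop_atTop.atTop_mul_const har')
  have hlim := ENNReal.Tendsto.sub (tendsto_const_nhds (x := (1 : ℝ≥0∞))) (hB.add hexp)
    (Or.inl ENNReal.one_ne_top)
  rw [add_zero, tsub_zero] at hlim
  rw [← hlim.liminf_eq]
  refine liminf_le_liminf ?_
  filter_upwards [hev, eventually_ge_atTop 1] with n hn hn1
  have hn0 : (0 : ℝ) < n := by exact_mod_cast hn1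
  have hM := (Φ n).one_le_size
  have hn' : r < 1 / (n : ℝ) * Real.log (Φ n).size := by exact_mod_cast hn
  rw [one_div_mul_eq_div, lt_div_iff₀ hn0] at hn'
  have hMexp : Real.exp (r * n) ≤ (Φ n).size := by
    rw [← Real.le_log_iff_exp_le (by linarith)]; exact hn'.le
  rw [tsub_le_iff_right, ← exceedance_add_shortfall (Φ n).uniformMessage
    ((Φ n).messageChannel (WB n)) (ENNReal.ofReal (Real.exp (n * a)))]
  refine add_le_add_right (((Φ n).shortfall_messageChannel_le (WB n) _).trans
    (add_le_add_right ?_ _)) _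
  rw [← ENNReal.ofReal_natCast, ← ENNReal.ofReal_div_of_pos (by linarith)]
  refine ENNReal.ofReal_le_ofReal ?_
  rw [div_le_iff₀ (by linarith)]
  calc Real.exp (n * a) = Real.exp (-(n * (r - a))) * Real.exp (r * n) := by
        rw [← Real.exp_add]; ring_nf
    _ ≤ _ := mul_le_mul_of_nonneg_left hMexp (Real.exp_pos _).le

lemma rate_le_prefixSup (hB : Tendsto (fun n => (Φ n).errorB (WB n)) atTop (𝓝 0))
    (hE : ∀ a : ℝ, 0 < a → Tendsto (fun n : ℕ => exceedance (Φ n).uniformMessage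
      ((Φ n).messageChannel (WE n)) (ENNReal.ofReal (Real.exp (n * a)))) atTop (𝓝 0)) :
    rate Φ ≤ prefixSup.{u, u₁, u₂, v} WB WE := by
  -- The lift only moves the message set to the universe over which the supremum runs.
  let p (n : ℕ) : PMF (ULift.{v} (Fin (Φ n).size)) := (Φ n).uniformMessage.map ULift.up
  let Q (n : ℕ) : Channel (ULift.{v} (Fin (Φ n).size)) (X n) := fun i => (Φ n).Q i.down
  have htailB {n : ℕ} (hn : 0 < n) (a : ℝ) : spectrumTail n (p n) (cascade (WB n) (Q n)) a =
      exceedance (Φ n).uniformMessage ((Φ n).messageChannel (WB n))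
        (ENNReal.ofReal (Real.exp (n * a))) := by
    rw [spectrumTail_eq hn, exceedance_map]; rfl
  have htailE {n : ℕ} (hn : 0 < n) (a : ℝ) : spectrumTail n (p n) (cascade (WE n) (Q n)) a =
      exceedance (Φ n).uniformMessage ((Φ n).messageChannel (WE n))
        (ENNReal.ofReal (Real.exp (n * a))) := by
    rw [spectrumTail_eq hn, exceedance_map]; rfl
  have hupper : upperI 0 p (fun n => cascade (WE n) (Q n)) ≤ 0 := by
    refine upperI_zero_nonpos fun a ha => (hE a ha).congr' ?_
    filter_upwards [eventually_ge_atTop 1] with n hn using (htailE hn a).symm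
  have hlower : rate Φ ≤ lowerI 1 p (fun n => cascade (WB n) (Q n)) := by
    refine le_sInf ?_
    rintro b ⟨a, rfl, ha⟩
    rw [if_pos rfl] at ha
    refine rate_le_of_liminf_exceedance_lt hB (lt_of_eq_of_lt (liminf_congr ?_) ha)
    filter_upwards [eventually_ge_atTop 1] with n hn using (htailB hn a).symm
  calc rate Φ = rate Φ - 0 := (sub_zero _).symm
    _ ≤ lowerI 1 p (fun n => cascade (WB n) (Q n)) -
        upperI 0 p (fun n => cascade (WE n) (Q n)) := EReal.sub_le_sub hlower hupper
    _ ≤ prefixSup.{u, u₁, u₂, v} WB WE :=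
      le_iSup_of_le (fun n => ULift.{v} (Fin (Φ n).size)) (le_iSup_of_le p (le_iSup_of_le Q le_rfl))

end Converse

/-! ### Direct part -/

section Direct

/-- Replaces possibly infinite spectrum quantities by real thresholds; ∞ - ∞ = -∞ is excluded by the
hypothesis. -/
lemma exists_real_lt_sub {x y : EReal} {R : ℝ} (h : (R : EReal) < x - y) :
    ∃ a b : ℝ, (a : EReal) < x ∧ y < b ∧ R < a - b := by
  induction y with
  | top => simp at h
  | bot =>
    induction x with
    | bot => simp at h
    | top => exact ⟨0, -R - 1, EReal.coe_lt_top _, EReal.bot_lt_coe _, by linarith⟩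
    | coe x =>
      exact ⟨x - 1, x - 1 - R - 1, by exact_mod_cast sub_one_lt x, EReal.bot_lt_coe _, by linarith⟩
  | coe y =>
    induction x with
    | bot => simp at h
    | top =>
      exact ⟨R + y + 2, y + 1, EReal.coe_lt_top _, by exact_mod_cast lt_add_one y, by linarith⟩
    | coe x =>
      have h' : R < x - y := by exact_mod_cast h
      exact ⟨x - (x - y - R) / 3, y + (x - y - R) / 3, by
        exact_mod_cast (by linarith : x - (x - y - R) / 3 < x), by
        exact_mod_cast (by linarith : y < y + (x - y - R) / 3), by linarith⟩

lemma tendsto_exp_neg_natCast_mul {c : ℝ} (hc : 0 < c) :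
    Tendsto (fun n : ℕ => Real.exp (-(n * c))) atTop (𝓝 0) :=
  Real.tendsto_exp_atBot.comp (tendsto_neg_atTop_atBot.comp
    (tendsto_natCast_atTop_atTop.atTop_mul_const hc))

lemma natCeil_exp_le {t : ℝ} (ht : 0 ≤ t) : (⌈Real.exp t⌉₊ : ℝ) ≤ 2 * Real.exp t := by
  have h1 := Nat.ceil_lt_add_one (Real.exp_pos t).le
  have h2 := Real.one_le_exp ht
  linarith

variable {X : ℕ → Type u} {Y : ℕ → Type u₁} {Z : ℕ → Type u₂}
  {WB : ∀ n, Channel (X n) (Y n)} {WE : ∀ n, Channel (X n) (Z n)}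

lemma rate_le_capacityD {Φ : ∀ n, Code (X n) (Y n)}
    (hB : Tendsto (fun n => (Φ n).errorB (WB n)) atTop (𝓝 0))
    (hE : Tendsto (fun n => (Φ n).distE (WE n)) atTop (𝓝 0)) : rate Φ ≤ capacityD WB WE :=
  le_sSup ⟨Φ, hB, hE, rfl⟩

/-- The bound on the size gives log M = O(n), which turns vanishing d_E into vanishing I_E / n. -/
lemma rate_le_capacityI {Φ : ∀ n, Code (X n) (Y n)} {R : ℝ}
    (hB : Tendsto (fun n => (Φ n).errorB (WB n)) atTop (𝓝 0))
    (hE : Tendsto (fun n => (Φ n).distE (WE n)) atTop (𝓝 0))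
    (hsize : ∀ n : ℕ, ((Φ n).size : ℝ) ≤ 2 * Real.exp (n * R)) : rate Φ ≤ capacityI WB WE := by
  refine le_sSup ⟨Φ, hB, ?_, rfl⟩
  simp_rw [infoE_div_eq]
  rw [← EReal.coe_zero]
  refine EReal.tendsto_coe.2 ?_
  refine squeeze_zero' (Eventually.of_forall fun n =>
    div_nonneg ((Φ n).infoEReal_nonneg (WE n)) n.cast_nonneg) ?_
    (by simpa using hE.mul_const (1 + Real.log 2 + R))
  filter_upwards [eventually_ge_atTop 1] with n hn
  have hn' : (1 : ℝ) ≤ n := by exact_mod_cast hn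
  have hM := (Φ n).one_le_size
  rw [div_le_iff₀ (by linarith), mul_assoc]
  refine ((Φ n).infoEReal_le (WE n)).trans
    (mul_le_mul_of_nonneg_left ?_ ((Φ n).distE_nonneg (WE n)))
  have hlog : Real.log (Φ n).size ≤ Real.log 2 + n * R := by
    refine (Real.log_le_log (by linarith) (hsize n)).trans_eq ?_
    rw [Real.log_mul two_ne_zero (Real.exp_pos _).ne', Real.log_exp]
  have h2 : 0 ≤ Real.log 2 := Real.log_nonneg one_le_two
  nlinarith [mul_nonneg (sub_nonneg.2 hn') h2]

lemma exists_codes {V : ℕ → Type v} {p : ∀ n, PMF (V n)} {Q : ∀ n, Channel (V n) (X n)}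
    {R a b : ℝ} (hR : 0 ≤ R) (hb : 0 ≤ b) (hRab : R < a - b)
    (hB : Tendsto (fun n : ℕ => shortfall (p n) (cascade (WB n) (Q n))
      (ENNReal.ofReal (Real.exp (n * a)))) atTop (𝓝 0))
    (hE : Tendsto (fun n : ℕ => exceedance (p n) (cascade (WE n) (Q n))
      (ENNReal.ofReal (Real.exp (n * b)))) atTop (𝓝 0)) :
    ∃ Φ : ∀ n, Code (X n) (Y n), (∀ n : ℕ, (Φ n).size = ⌈Real.exp (n * R)⌉₊) ∧
      Tendsto (fun n => (Φ n).errorB (WB n)) atTop (𝓝 0) ∧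
      Tendsto (fun n => (Φ n).distE (WE n)) atTop (𝓝 0) := by
  -- The slack a - b - R is split evenly: with L ≈ e^{n(b+δ)}, both ML / e^{na} and e^{nb} / L are
  -- of order e^{-nδ}.
  set δ : ℝ := (a - b - R) / 2 with hδ
  have hδ0 : 0 < δ := by linarith
  have hceil (t : ℝ) : 0 < ⌈Real.exp t⌉₊ := Nat.ceil_pos.2 (Real.exp_pos t)
  have hex (n : ℕ) := exists_code (p n) (Q n) (WB n) (WE n) (hceil (n * R))
    (hceil (n * (b + δ))) (ENNReal.ofReal (Real.exp (n * a))) (Real.exp_pos (n * b)).le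
  choose Φ hsize hΦ using hex
  have hML : Tendsto (fun n : ℕ => (⌈Real.exp (n * R)⌉₊ : ℝ≥0∞) * ⌈Real.exp (n * (b + δ))⌉₊ /
      ENNReal.ofReal (Real.exp (n * a))) atTop (𝓝 0) := by
    have hlim := ENNReal.tendsto_ofReal ((tendsto_exp_neg_natCast_mul hδ0).const_mul 4)
    rw [mul_zero, ENNReal.ofReal_zero] at hlim
    refine tendsto_of_tendsto_of_tendsto_of_le_of_le tendsto_const_nhds hlim
      (fun _ => zero_le) fun n => ?_
    rw [← ENNReal.ofReal_natCast, ← ENNReal.ofReal_natCast, ← ENNReal.ofReal_mul (by positivity),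
      ← ENNReal.ofReal_div_of_pos (Real.exp_pos _)]
    refine ENNReal.ofReal_le_ofReal ?_
    rw [div_le_iff₀ (Real.exp_pos _)]
    calc (⌈Real.exp (n * R)⌉₊ : ℝ) * ⌈Real.exp (n * (b + δ))⌉₊
        ≤ (2 * Real.exp (n * R)) * (2 * Real.exp (n * (b + δ))) :=
          mul_le_mul (natCeil_exp_le (mul_nonneg n.cast_nonneg hR)) (natCeil_exp_le (by positivity))
            (by positivity) (by positivity)
      _ = 4 * (Real.exp (n * R) * Real.exp (n * (b + δ))) := by ring
      _ = 4 * (Real.exp (-(n * δ)) * Real.exp (n * a)) := by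
          rw [← Real.exp_add, ← Real.exp_add, hδ]; ring_nf
      _ = _ := by ring
  have hsqrt : Tendsto (fun n : ℕ => ENNReal.ofReal
      √(Real.exp (n * b) / ⌈Real.exp (n * (b + δ))⌉₊)) atTop (𝓝 0) := by
    have hlim := ENNReal.tendsto_ofReal ((Real.continuous_sqrt.tendsto 0).comp
      (tendsto_exp_neg_natCast_mul hδ0))
    rw [Real.sqrt_zero, ENNReal.ofReal_zero] at hlim
    refine tendsto_of_tendsto_of_tendsto_of_le_of_le tendsto_const_nhds hlim
      (fun _ => zero_le) fun n => ?_
    refine ENNReal.ofReal_le_ofReal (Real.sqrt_le_sqrt ?_)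
    rw [div_le_iff₀ (by exact_mod_cast hceil _)]
    calc Real.exp (n * b) = Real.exp (-(n * δ)) * Real.exp (n * (b + δ)) := by
          rw [← Real.exp_add]; ring_nf
      _ ≤ _ := mul_le_mul_of_nonneg_left (Nat.le_ceil _) (Real.exp_pos _).le
  have hsum := (hB.add hML).add (ENNReal.Tendsto.const_mul
    (hsqrt.add (ENNReal.Tendsto.const_mul hE (Or.inr (ENNReal.ofNat_ne_top (n := 2)))))
    (Or.inr (ENNReal.ofNat_ne_top (n := 2))))
  simp only [mul_zero, add_zero] at hsum
  refine ⟨Φ, hsize, ?_, ?_⟩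
  · exact tendsto_of_tendsto_of_tendsto_of_le_of_le tendsto_const_nhds hsum
      (fun _ => zero_le) fun n => le_self_add.trans (hΦ n)
  · have h : Tendsto (fun n => ENNReal.ofReal ((Φ n).distE (WE n))) atTop (𝓝 0) :=
      tendsto_of_tendsto_of_tendsto_of_le_of_le tendsto_const_nhds hsum
        (fun _ => zero_le) fun n => le_add_self.trans (hΦ n)
    refine ((ENNReal.tendsto_toReal ENNReal.zero_ne_top).comp h).congr fun n => ?_
    exact ENNReal.toReal_ofReal ((Φ n).distE_nonneg (WE n))

lemma le_rate {Φ : ∀ n, Code (X n) (Y n)} {R : ℝ}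
    (h : ∀ n : ℕ, Real.exp (n * R) ≤ (Φ n).size) : (R : EReal) ≤ rate Φ := by
  refine le_liminf_of_le (by isBoundedDefault) ?_
  filter_upwards [eventually_ge_atTop 1] with n hn
  have hn0 : (0 : ℝ) < n := by exact_mod_cast hn
  rw [EReal.coe_le_coe_iff, one_div_mul_eq_div, le_div_iff₀ hn0, mul_comm,
    Real.le_log_iff_exp_le (lt_of_lt_of_le one_pos (Φ n).one_le_size)]
  exact h n

lemma exists_trivial_codes (x : ∀ n, PMF (X n)) :
    ∃ Φ : ∀ n, Code (X n) (Y n), (∀ n : ℕ, (Φ n).size = 1) ∧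
      Tendsto (fun n => (Φ n).errorB (WB n)) atTop (𝓝 0) ∧
      Tendsto (fun n => (Φ n).distE (WE n)) atTop (𝓝 0) := by
  refine ⟨fun n => ⟨1, one_pos, fun _ => x n, fun _ => Set.univ,
    fun i j hij => (hij (Subsingleton.elim i j)).elim⟩, fun _ => rfl, ?_, ?_⟩
  · simp [Code.errorB]
  · simp [Code.distE]

lemma exists_codes_of_lt {V : ℕ → Type v} {p : ∀ n, PMF (V n)} {Q : ∀ n, Channel (V n) (X n)}
    {R : ℝ} (hR : 0 ≤ R)
    (h : (R : EReal) < lowerI 1 p (fun n => cascade (WB n) (Q n)) -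
      upperI 0 p (fun n => cascade (WE n) (Q n))) :
    ∃ Φ : ∀ n, Code (X n) (Y n), (∀ n : ℕ, (Φ n).size = ⌈Real.exp (n * R)⌉₊) ∧
      Tendsto (fun n => (Φ n).errorB (WB n)) atTop (𝓝 0) ∧
      Tendsto (fun n => (Φ n).distE (WE n)) atTop (𝓝 0) := by
  obtain ⟨a, b', ha, hb', hRab'⟩ := exists_real_lt_sub h
  obtain ⟨_, ⟨b, rfl, hb⟩, hbb'⟩ := sInf_lt_iff.1 hb'
  have hRab : R < a - b := by
    have : b < b' := by exact_mod_cast hbb'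
    linarith
  rw [if_neg zero_ne_one] at hb
  have hE' : Tendsto (fun n => spectrumTail n (p n) (cascade (WE n) (Q n)) b) atTop (𝓝 0) :=
    tendsto_of_le_liminf_of_limsup_le zero_le hb
  have hE : Tendsto (fun n : ℕ => exceedance (p n) (cascade (WE n) (Q n))
      (ENNReal.ofReal (Real.exp (n * b)))) atTop (𝓝 0) := by
    refine hE'.congr' ?_
    filter_upwards [eventually_ge_atTop 1] with n hn using spectrumTail_eq hn _ _ _
  -- For b < 0 exceedance and shortfall could not sum to 1: the first vanishes and the second is at
  -- most e^{nb} ≤ e^b < 1.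
  have hb0 : 0 ≤ b := by
    by_contra! hneg
    have hlim := hE.add_const (ENNReal.ofReal (Real.exp b))
    rw [zero_add] at hlim
    have : 1 ≤ ENNReal.ofReal (Real.exp b) := by
      refine ge_of_tendsto hlim ?_
      filter_upwards [eventually_ge_atTop 1] with n hn
      have hn' : (1 : ℝ) ≤ n := by exact_mod_cast hn
      rw [← exceedance_add_shortfall (p n) (cascade (WE n) (Q n))
        (ENNReal.ofReal (Real.exp (n * b)))]
      refine add_le_add_right ((shortfall_le _ _ _).trans
        (ENNReal.ofReal_le_ofReal (Real.exp_le_exp.2 ?_))) _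
      nlinarith
    rw [ENNReal.one_le_ofReal] at this
    exact absurd (Real.exp_lt_one_iff.2 hneg) (not_lt.2 this)
  -- Below the infimum defining I̲(1) the liminf is at least 1; as exceedances never exceed 1, they
  -- converge to 1.
  have ha1 : 1 ≤ liminf (fun n => spectrumTail n (p n) (cascade (WB n) (Q n)) a) atTop := by
    by_contra! hlt
    exact not_le.2 ha (sInf_le ⟨a, rfl, by rwa [if_pos rfl]⟩)
  have hB : Tendsto (fun n : ℕ => shortfall (p n) (cascade (WB n) (Q n))
      (ENNReal.ofReal (Real.exp (n * a)))) atTop (𝓝 0) := by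
    have hcongr : (fun n : ℕ => spectrumTail n (p n) (cascade (WB n) (Q n)) a) =ᶠ[atTop]
        fun n : ℕ => exceedance (p n) (cascade (WB n) (Q n))
          (ENNReal.ofReal (Real.exp (n * a))) := by
      filter_upwards [eventually_ge_atTop 1] with n hn using spectrumTail_eq hn _ _ _
    rw [liminf_congr hcongr] at ha1
    have hT := tendsto_of_le_liminf_of_limsup_le ha1
      (limsup_le_of_le (by isBoundedDefault)
        (Eventually.of_forall fun n => exceedance_le_one _ _ _))
    have hlim := ENNReal.Tendsto.sub (tendsto_const_nhds (x := (1 : ℝ≥0∞))) hT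
      (Or.inl ENNReal.one_ne_top)
    rw [tsub_self] at hlim
    refine hlim.congr fun n => ?_
    rw [← exceedance_add_shortfall (p n) (cascade (WB n) (Q n))
      (ENNReal.ofReal (Real.exp (n * a)))]
    exact ENNReal.add_sub_cancel_left (exceedance_ne_top _ _ _)
  exact exists_codes hR hb0 hRab hB hE

lemma prefixSup_le : prefixSup.{u, u₁, u₂, v} WB WE ≤ min (capacityD WB WE) (capacityI WB WE) := by
  refine iSup_le fun V => iSup_le fun p => iSup_le fun Q => le_of_forall_lt fun c hc => ?_
  obtain ⟨R, hcR, hR⟩ := EReal.lt_iff_exists_real_btwn.1 hc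
  refine hcR.trans_le ?_
  rcases le_or_gt 0 R with hR0 | hR0
  · obtain ⟨Φ, hsize, hB, hE⟩ := exists_codes_of_lt hR0 hR
    refine (le_rate fun n => ?_).trans (le_min (rate_le_capacityD hB hE)
      (rate_le_capacityI (R := R) hB hE fun n => ?_))
    · rw [hsize]; exact Nat.le_ceil _
    · rw [hsize]; exact natCeil_exp_le (by positivity)
  -- A negative rate needs only one message; the prefix supplies the input distribution, so no
  -- separate nonemptiness of the alphabets is needed.
  · obtain ⟨Φ, hsize, hB, hE⟩ := exists_trivial_codes (WB := WB) (WE := WE)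
      fun n => output (Q n) (p n)
    refine (le_rate fun n => ?_).trans (le_min (rate_le_capacityD hB hE)
      (rate_le_capacityI (R := 0) hB hE fun n => ?_))
    · rw [hsize, Nat.cast_one, Real.exp_le_one_iff]
      exact mul_nonpos_of_nonneg_of_nonpos n.cast_nonneg hR0.le
    · simp [hsize]

end Direct

end WireTap

theorem mainTheorem2 {X : ℕ → Type u} {Y : ℕ → Type u₁} {Z : ℕ → Type u₂}
    (WB : ∀ n, WireTap.Channel (X n) (Y n)) (WE : ∀ n, WireTap.Channel (X n) (Z n)) :
    WireTap.capacityD WB WE = WireTap.capacityI WB WE ∧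
      WireTap.capacityI WB WE = WireTap.prefixSup.{u, u₁, u₂, v} WB WE := by
  have hD : WireTap.capacityD WB WE = WireTap.prefixSup.{u, u₁, u₂, v} WB WE := by
    refine le_antisymm (sSup_le ?_) (WireTap.prefixSup_le.trans (min_le_left _ _))
    rintro _ ⟨Φ, hB, hE, rfl⟩
    exact WireTap.rate_le_prefixSup hB fun a ha => WireTap.tendsto_exceedance_of_distE hE ha
  have hI : WireTap.capacityI WB WE = WireTap.prefixSup.{u, u₁, u₂, v} WB WE := by
    refine le_antisymm (sSup_le ?_) (WireTap.prefixSup_le.trans (min_le_right _ _))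
    rintro _ ⟨Φ, hB, hE, rfl⟩
    exact WireTap.rate_le_prefixSup hB fun a ha => WireTap.tendsto_exceedance_of_infoE hE ha
  exact ⟨hD.trans hI.symm, hI⟩
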